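/- An ordered non-crossing pair-partition of $[2k]=\{1,\dots,2k\}$ is a sequence $P=(P_1,\dots,P_k)$ listing, in some order and without repetition, the blocks of a partition of $[2k]$ into two-element blocks such that there are no $a<b<c<d$ with $a,c$ in one block and $b,d$ in another. The set of these is $\mathcal{ONC}^2_{2k}$ (for $k=0$ it consists of the empty sequence). The block $P_i$ lies immediately under $P_j$ if $P_j$ contains elements $a,b$ with $a<c<b$ for all $c\in P_i$, and no third block $P_l$ lies in this sense both under $P_j$ and above $P_i$. Let $e(P)$ be the number of pairs $i<j$ such that $P_i$ lies immediately under $P_j$ (disorders) and $e'(P)$ the number of pairs $i<j$ such that $P_j$ lies immediately under $P_i$ (orders). **Theorem 2.1.** Fix $p,q\ge 0$ with $p+q>0$, and for $k\ge 0$ let (with $0^0=1$) $$r_k=\frac1{k!}\sum_{P\in\mathcal{ONC}^2_{2k}}p^{e(P)}q^{e'(P)} ,\qquad m_{2k}=r_k,\quad m_{2k+1}=0 .$$ Let $\mu_{p,q}$ (the Kesten law) be the Borel measure on $\mathbb R$ which is the sum of the absolutely continuous measure with density $$f_{p,q}(x)=\frac1\pi\,\frac{\sqrt{2(p+q)-x^2}}{2-(2-p-q)x^2},\qquad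 x\in[-\sqrt{2(p+q)},\sqrt{2(p+q)}],$$ and, when $p+q<1$, of two atoms at $\pm 1/\sqrt{1-(p+q)/2}$, each of mass $\dfrac{1-(p+q)}{2-(p+q)}$. Then: 1. $\mu_{p,q}$ is a probability measure, all its moments are finite, and $\int x^n\,d\mu_{p,q}(x)=m_n$ for all $n\ge0$. 2. $\mu_{p,q}$ is the only Borel measure on $\mathbb R$ with finite moments of all orders equal to $(m_n)_{n\ge0}$. 3. For every $z\in\mathbb C\setminus[-\sqrt{2(p+q)},\sqrt{2(p+q)}]$ with $2-(2-p-q)z^2\ne0$, the function $x\mapsto 1/(z-x)$ is $\mu_{p,q}$-integrable and $$\int\frac{d\mu_{p,q}(x)}{z-x}=\frac{(p+q-1)z-\sqrt{z^2-2(p+q)}}{2-(2-p-q)z^2},$$ where $\sqrt{z^2-2(p+q)}=\sqrt{z-\sqrt{2(p+q)}}\,\sqrt{z+\sqrt{2(p+q)}}$ (principal square roots on the right) is the branch that is analytic on $\mathbb C\setminus[-\sqrt{2(p+q)},\sqrt{2(p+q)}]$ and asymptotic to $z$ at infinity. -/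

import Mathlib

open MeasureTheory

/-! ### Ordered non-crossing pair-partitions

An ordered partition of the set of `n` points `Fin n` into `b` blocks is the sequence
`P = (P 0, …, P (b - 1))` of its blocks. -/

namespace OrdPart

variable {n b : ℕ}

/-- The finite sets `P i` are the blocks, listed without repetition, of a partition of `Fin n`. -/
def IsOrderedPartition (P : Fin b → Finset (Fin n)) : Prop :=
  (∀ i, (P i).Nonempty) ∧ (∀ i j, i ≠ j → Disjoint (P i) (P j)) ∧ ∀ x, ∃ i, x ∈ P i

/-- Every block has exactly two elements. -/
def IsPairing (P : Fin b → Finset (Fin n)) : Prop :=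
  ∀ i, (P i).card = 2

/-- There are no `k, k'` in one block and `m, m'` in another one with `k < m < k' < m'`. -/
def IsNonCrossing (P : Fin b → Finset (Fin n)) : Prop :=
  ∀ i j, i ≠ j → ∀ k ∈ P i, ∀ k' ∈ P i, ∀ m ∈ P j, ∀ m' ∈ P j, ¬ (k < m ∧ m < k' ∧ k' < m')

/-- `Outer P j i`: the block `P j` is outer with respect to `P i`
(equivalently, `P i` is inner with respect to `P j`). -/
def Outer (P : Fin b → Finset (Fin n)) (j i : Fin b) : Prop :=
  i ≠ j ∧ ∃ x ∈ P j, ∃ y ∈ P j, ∀ c ∈ P i, x < c ∧ c < y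

/-- `Covers P j i`: the blocks `P j`, `P i` are neighboring and `P j` is outer with respect to
`P i`, i.e. `P i` lies immediately under `P j`, with no intermediate block. -/
def Covers (P : Fin b → Finset (Fin n)) (j i : Fin b) : Prop :=
  Outer P j i ∧ ∀ k, (Outer P j k ∨ k = j) → (Outer P k i ∨ k = i) → k = i ∨ k = j

instance (P : Fin b → Finset (Fin n)) : Decidable (IsOrderedPartition P) := by
  unfold IsOrderedPartition; infer_instance

instance (P : Fin b → Finset (Fin n)) : Decidable (IsPairing P) := by
  unfold IsPairing; infer_instance

instance (P : Fin b → Finset (Fin n)) : Decidable (IsNonCrossing P) := by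
  unfold IsNonCrossing; infer_instance

instance (P : Fin b → Finset (Fin n)) (j i : Fin b) : Decidable (Outer P j i) := by
  unfold Outer; infer_instance

instance (P : Fin b → Finset (Fin n)) (j i : Fin b) : Decidable (Covers P j i) := by
  unfold Covers; infer_instance

/-- The number `e(P)` of disorders: pairs `i < j` such that `P i` lies immediately under `P j`. -/
def disorders (P : Fin b → Finset (Fin n)) : ℕ :=
  (Finset.univ.filter fun ij : Fin b × Fin b => ij.1 < ij.2 ∧ Covers P ij.2 ij.1).card

/-- The number `e'(P)` of orders: pairs `i < j` such that `P j` lies immediately under `P i`. -/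
def orders (P : Fin b → Finset (Fin n)) : ℕ :=
  (Finset.univ.filter fun ij : Fin b × Fin b => ij.1 < ij.2 ∧ Covers P ij.1 ij.2).card

/-- A pairing of `2k` points has `k` blocks. -/
theorem blocks_eq_of_isPairing {k : ℕ} {P : Fin b → Finset (Fin (2 * k))}
    (h : IsOrderedPartition P) (h2 : IsPairing P) : b = k := by
  have hu : Finset.univ.biUnion P = Finset.univ := by
    ext x
    simpa using h.2.2 x
  have hc := Finset.card_biUnion (s := Finset.univ) (t := P)
    (fun i _ j _ hij => h.2.1 i j hij)
  rw [hu] at hc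
  simp only [h2 _, Finset.card_univ, Fintype.card_fin, Finset.sum_const, smul_eq_mul] at hc
  omega

/-- The set of all ordered non-crossing pair-partitions of a set of `2k` points
(they all have exactly `k` blocks, see `blocks_eq_of_isPairing`). -/
def ONC2 (k : ℕ) : Finset (Fin k → Finset (Fin (2 * k))) :=
  Finset.univ.filter fun P => IsOrderedPartition P ∧ IsNonCrossing P ∧ IsPairing P

end OrdPart

/-! ### The moment sequence -/

/-- `r_k = (1/k!) ∑_P p ^ e(P) * q ^ e'(P)`, the sum over ordered non-crossing pair-partitions `P`
of a set of `2k` points. For `k = 0` the only such `P` is the empty sequence, so `r_0 = 1`. -/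
noncomputable def kestenR (p q : ℝ) (k : ℕ) : ℝ :=
  1 / (k.factorial : ℝ) *
    ∑ P ∈ OrdPart.ONC2 k, p ^ OrdPart.disorders P * q ^ OrdPart.orders P

/-- The sequence `m` with `m (2k) = r_k` and `m n = 0` for odd `n`. -/
noncomputable def kestenMoment (p q : ℝ) (n : ℕ) : ℝ :=
  if Even n then kestenR p q (n / 2) else 0

/-- The measure `μ` on the real line has finite moments of all orders, and they are `m`. -/
def HasMoments (μ : Measure ℝ) (m : ℕ → ℝ) : Prop :=
  ∀ n : ℕ, Integrable (fun x : ℝ => x ^ n) μ ∧ ∫ x, x ^ n ∂μ = m n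

/-! ### The Kesten law -/

/-- The density of the absolutely continuous part, on `[-√(2(p+q)), √(2(p+q))]`. -/
noncomputable def kestenDensity (p q x : ℝ) : ℝ :=
  1 / Real.pi * (Real.sqrt (2 * (p + q) - x ^ 2) / (2 - (2 - p - q) * x ^ 2))

/-- The location of the positive atom (when `p + q < 1`). -/
noncomputable def kestenAtom (p q : ℝ) : ℝ :=
  1 / Real.sqrt (1 - (p + q) / 2)

/-- The mass of each of the two atoms; there are none unless `p + q < 1`. -/
noncomputable def kestenMass (p q : ℝ) : ℝ :=
  if p + q < 1 then (1 - (p + q)) / (2 - (p + q)) else 0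

/-- The Kesten law. -/
noncomputable def kestenLaw (p q : ℝ) : Measure ℝ :=
  (volume.restrict (Set.Icc (-Real.sqrt (2 * (p + q))) (Real.sqrt (2 * (p + q))))).withDensity
      (fun x => ENNReal.ofReal (kestenDensity p q x)) +
    ENNReal.ofReal (kestenMass p q) •
      (Measure.dirac (kestenAtom p q) + Measure.dirac (-kestenAtom p q))

/-! ### The square root in the Cauchy transform -/

/-- The branch of `√(z² - a²)` which is analytic on `ℂ` minus the segment `[-a, a]` and
asymptotic to `z` at infinity (a product of principal square roots). -/
noncomputable def sqrtBranch (a : ℝ) (z : ℂ) : ℂ :=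
  (z - (a : ℂ)) ^ (1 / 2 : ℂ) * (z + (a : ℂ)) ^ (1 / 2 : ℂ)

/-!
The sums over ordered non-crossing pairings are sums over labelled plane forests, and these depend
on `p` and `q` only through `p + q`.

**Combinatorics.** An ordered non-crossing pairing is a word in which every letter (the index of a
block) occurs twice and no `i j i j` occurs as a subword. Such words are exactly the contour words
of plane forests with distinct labels (`PlaneForest.word_injOn`, `PlaneForest.exists_word_eq`), and
"immediately under" becomes "child of" (`PlaneForest.covers_blocks`). An edge has weight `p` or `q`
according to the order of its two labels. Cut a labelled tree with more than one node at its last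
branch at the root: this gives two trees `T₁`, `T₂` with complementary label sets, and an edge
between their two roots. Since the roles of `T₁` and `T₂` can be exchanged, that edge contributes
`(p + q) / 2` on average (`PlaneForest.sum_treeWeight`). Hence the exponential generating function
`B` of trees satisfies `B = X + c B ^ 2` with `c = (p + q) / 2`, that of forests is
`R = 1 / (1 - B)`, and therefore `r k - (1 - c) r (k + 1) = c ^ (k + 1) catalan k` (`kestenR_sub`).

**Analysis.** Multiplied by `1 - (1 - c) x ^ 2`, the Kesten law loses its atoms and becomes `c`
times the semicircle law of variance `c` (`integral_kestenLaw_mul_quadratic`). So its moments satisfy the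
recursion of `r`, and its Cauchy transform follows from that of the semicircle law, provided that
its total mass is `1`. With `x = 2 √c cos t` all these integrals reduce to
`∫ sin² t / (1 - 2 w cos t + w²) dt = π / 2` for `|w| < 1` (`integral_sin_sq_div`), a consequence of
the expansion of the integrand in `sin ((n + 1) t)`.

**Uniqueness.** A measure with the moments of one of bounded support has bounded support by
Chebyshev's inequality, and polynomials are dense in the continuous functions on a bounded interval
(`eq_of_hasMoments`).
-/

/-! ### Labelled plane forests and their words -/

open scoped List in
theorem List.Sublist.of_append_of_notMem_right {α : Type*} {j : α} {l l₁ l₂ : List α}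
    (h : l ++ [j] <+ l₁ ++ l₂) (hj : j ∉ l₂) : l ++ [j] <+ l₁ := by
  induction l₂ using List.reverseRecOn with
  | nil => simpa using h
  | append_singleton l₂ b ih =>
    simp only [List.mem_append, List.mem_singleton, not_or] at hj
    apply ih _ hj.1
    rw [← List.append_assoc, ← List.reverse_sublist] at h
    simp only [List.reverse_append, List.reverse_singleton, List.singleton_append] at h
    rw [← List.reverse_sublist]
    cases h with
    | cons _ h => simpa using h
    | cons_cons => exact absurd rfl hj.2

open scoped List in
theorem List.Sublist.of_append_of_notMem_left {α : Type*} {j : α} {l l₁ l₂ : List α}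
    (h : j :: l <+ l₁ ++ l₂) (hj : j ∉ l₁) : j :: l <+ l₂ := by
  induction l₁ with
  | nil => simpa using h
  | cons b l₁ ih =>
    simp only [List.mem_cons, not_or] at hj
    apply ih _ hj.2
    cases h with
    | cons _ h => simpa using h
    | cons_cons => exact absurd rfl hj.1

/-- Plane forests with labelled nodes. `snoc F a G` is the forest `F` followed by one more tree,
whose root carries the label `a` and whose root has the forest `G` hanging below it. -/
inductive PlaneForest (α : Type*)
  | nil : PlaneForest α
  | snoc (F : PlaneForest α) (a : α) (G : PlaneForest α) : PlaneForest α

namespace PlaneForest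

open scoped List

variable {α : Type*}

/-- The labels of the roots, from left to right. -/
def roots : PlaneForest α → List α
  | nil => []
  | snoc F a _ => F.roots ++ [a]

/-- The labels of all nodes. -/
def labels : PlaneForest α → List α
  | nil => []
  | snoc F a G => F.labels ++ a :: G.labels

/-- The word of labels read while walking around the forest: each label is written when its node is
entered and when it is left. Reading each letter as the block of a position, this is a
non-crossing pairing. -/
def word : PlaneForest α → List α
  | nil => []
  | snoc F a G => F.word ++ a :: (G.word ++ [a])

/-- The pairs (label of a node, label of one of its children). -/
def edges : PlaneForest α → List (α × α)
  | nil => []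
  | snoc F a G => F.edges ++ (G.edges ++ G.roots.map (Prod.mk a))

theorem mem_word {F : PlaneForest α} {i : α} : i ∈ F.word ↔ i ∈ F.labels := by
  induction F with
  | nil => simp [word, labels]
  | snoc F a G hF hG => simp only [word, labels, List.mem_append, List.mem_cons, hF, hG]; grind

theorem count_word [DecidableEq α] (F : PlaneForest α) (i : α) :
    F.word.count i = 2 * F.labels.count i := by
  induction F with
  | nil => simp [word, labels]
  | snoc F a G hF hG =>
    simp only [word, labels, List.count_append, List.count_cons, hF, hG, List.count_nil]
    split <;> ring

theorem length_word (F : PlaneForest α) : F.word.length = 2 * F.labels.length := by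
  induction F with
  | nil => simp [word, labels]
  | snoc F a G hF hG => simp [word, labels, hF, hG]; ring

theorem mem_labels_of_mem_roots {F : PlaneForest α} {i : α} (h : i ∈ F.roots) : i ∈ F.labels := by
  induction F with
  | nil => simp [roots] at h
  | snoc F a G hF hG => simp only [roots, labels] at *; grind

theorem nodup_labels_snoc {F G : PlaneForest α} {a : α} :
    (snoc F a G).labels.Nodup ↔ F.labels.Nodup ∧ G.labels.Nodup ∧ a ∉ F.labels ∧ a ∉ G.labels ∧
      ∀ i ∈ F.labels, i ∉ G.labels := by
  simp only [labels, List.nodup_append, List.nodup_cons]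
  grind

theorem nodup_roots {F : PlaneForest α} (h : F.labels.Nodup) : F.roots.Nodup := by
  induction F with
  | nil => simp [roots]
  | snoc F a G hF hG =>
    rw [nodup_labels_snoc] at h
    have := @mem_labels_of_mem_roots _ F
    simp only [roots, List.nodup_append]
    grind

theorem pair_sublist_word {F : PlaneForest α} {i : α} (h : i ∈ F.labels) : [i, i] <+ F.word := by
  classical
  have : [i, i] = List.replicate 2 i := rfl
  rw [this, List.replicate_sublist_iff, count_word]
  have := List.count_pos_iff.2 h
  omega

/-- The word of a forest with distinct labels is non-crossing. -/
theorem not_crossing_word {F : PlaneForest α} (h : F.labels.Nodup) {i j : α} (hij : i ≠ j) :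
    ¬ [i, j, i, j] <+ F.word := by
  induction F with
  | nil => simp [word]
  | snoc F a G hF hG =>
    rw [nodup_labels_snoc] at h
    obtain ⟨h1, h2, h3, h4, h5⟩ := h
    intro hs
    simp only [word] at hs
    by_cases hjF : j ∈ F.labels
    · exact hF h1 (List.Sublist.of_append_of_notMem_right (l := [i, j, i]) hs (by
        simp only [List.mem_cons, List.mem_append, mem_word]; grind))
    by_cases hiF : i ∈ F.labels
    · have hs' : [i, j, i] <+ F.word :=
        List.Sublist.of_append_of_notMem_right (l := [i, j])
          ((by simp : [i, j, i] <+ [i, j, i, j]).trans hs) (by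
            simp only [List.mem_cons, List.mem_append, mem_word]; grind)
      exact hjF (mem_word.1 (hs'.subset (by simp)))
    have hs := List.Sublist.of_append_of_notMem_left hs (by rwa [mem_word])
    by_cases hia : i = a
    · subst hia
      have hs : [i, j, i, j] <+ i :: G.word :=
        List.Sublist.of_append_of_notMem_right (l := [i, j, i]) (l₂ := [i]) (by simpa using hs)
          (by simpa using hij.symm)
      have hs := List.cons_sublist_cons.1 hs
      exact h4 (mem_word.1 (hs.subset (by simp)))
    have hs : [i, j, i, j] <+ G.word ++ [a] :=
      List.Sublist.of_append_of_notMem_left (l₁ := [a]) hs (by simpa using hia)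
    by_cases hja : j = a
    · subst hja
      have hs' : [i, j, i] <+ G.word :=
        List.Sublist.of_append_of_notMem_right (l := [i, j])
          ((by simp : [i, j, i] <+ [i, j, i, j]).trans hs) (by simpa using hia)
      exact h4 (mem_word.1 (hs'.subset (by simp)))
    · exact hG h2 (List.Sublist.of_append_of_notMem_right (l := [i, j, i]) hs (by simpa using hja))

/-- The node labelled `j` is a proper ancestor of the one labelled `i`. -/
def Anc : PlaneForest α → α → α → Prop
  | nil, _, _ => False
  | snoc F a G, j, i => F.Anc j i ∨ G.Anc j i ∨ (j = a ∧ i ∈ G.labels)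

theorem Anc.mem {F : PlaneForest α} {j i : α} (h : F.Anc j i) : j ∈ F.labels ∧ i ∈ F.labels := by
  induction F with
  | nil => exact h.elim
  | snoc F a G hF hG => simp only [Anc, labels] at *; grind

theorem Anc.ne {F : PlaneForest α} (hn : F.labels.Nodup) {j i : α} (h : F.Anc j i) : i ≠ j := by
  induction F with
  | nil => exact h.elim
  | snoc F a G hF hG => rw [nodup_labels_snoc] at hn; simp only [Anc] at *; grind

theorem anc_iff_sublist {F : PlaneForest α} (hn : F.labels.Nodup) {j i : α} :
    F.Anc j i ↔ i ≠ j ∧ [j, i, i, j] <+ F.word := by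
  refine ⟨fun h => ⟨h.ne hn, ?_⟩, fun h => ?_⟩
  · induction F with
    | nil => exact h.elim
    | snoc F a G hF hG =>
      rw [nodup_labels_snoc] at hn
      rcases h with h | h | ⟨rfl, h⟩
      · exact (hF hn.1 h).trans (by simp [word])
      · exact (hG hn.2.1 h).trans (((List.sublist_append_left _ _).trans
          (List.sublist_cons_self _ _)).trans (List.sublist_append_right _ _))
      · have h1 : [j, i, i, j] <+ j :: (G.word ++ [j]) :=
          List.cons_sublist_cons.2 ((pair_sublist_word h).append (List.Sublist.refl [j]))
        exact h1.trans (List.sublist_append_right _ _)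
  · obtain ⟨hij, hs⟩ := h
    induction F with
    | nil => simp [word] at hs
    | snoc F a G hF hG =>
      rw [nodup_labels_snoc] at hn
      obtain ⟨h1, h2, h3, h4, h5⟩ := hn
      simp only [word] at hs
      by_cases hjF : j ∈ F.labels
      · exact Or.inl (hF h1 (List.Sublist.of_append_of_notMem_right (l := [j, i, i]) hs (by
          simp only [List.mem_cons, List.mem_append, mem_word]; grind)))
      have hs := List.Sublist.of_append_of_notMem_left hs (by rwa [mem_word])
      by_cases hja : j = a
      · subst hja
        have hs := (List.cons_sublist_cons.1 hs).subset (show i ∈ [i, i, j] by simp)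
        simp only [List.mem_append, List.mem_singleton, mem_word] at hs
        exact Or.inr (Or.inr ⟨rfl, hs.resolve_right hij⟩)
      · have hs := List.Sublist.of_append_of_notMem_left (l₁ := [a]) hs (by simpa using hja)
        exact Or.inr (Or.inl (hG h2 (List.Sublist.of_append_of_notMem_right (l := [j, i, i]) hs
          (by simpa using hja))))

theorem mem_roots {F : PlaneForest α} (hn : F.labels.Nodup) {i : α} :
    i ∈ F.roots ↔ i ∈ F.labels ∧ ∀ j, ¬ F.Anc j i := by
  induction F with
  | nil => simp [roots, labels]
  | snoc F a G hF hG =>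
    rw [nodup_labels_snoc] at hn
    have hF := hF hn.1
    have hG := hG hn.2.1
    have h1 := @Anc.mem _ F
    have h2 := @Anc.mem _ G
    simp only [roots, labels, Anc, List.mem_append, List.mem_cons, List.not_mem_nil, or_false,
      hF]
    grind

/-- The edges are the covering pairs of the ancestor relation. -/
theorem mem_edges {F : PlaneForest α} (hn : F.labels.Nodup) {j i : α} :
    (j, i) ∈ F.edges ↔ F.Anc j i ∧ ∀ k, ¬ (F.Anc j k ∧ F.Anc k i) := by
  induction F with
  | nil => simp [edges, Anc]
  | snoc F a G hF hG =>
    rw [nodup_labels_snoc] at hn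
    have hF := hF hn.1
    have hG := hG hn.2.1
    have hr := @mem_roots _ G hn.2.1 i
    have h1 := @Anc.mem _ F
    have h2 := @Anc.mem _ G
    simp only [edges, Anc, List.mem_append, List.mem_map, Prod.mk.injEq, hF, hG]
    constructor
    · rintro (h | h | ⟨x, hx, rfl, rfl⟩) <;> grind
    · rintro ⟨h | h | ⟨rfl, h⟩, h'⟩ <;> grind

theorem nodup_edges {F : PlaneForest α} (hn : F.labels.Nodup) : F.edges.Nodup := by
  induction F with
  | nil => simp [edges]
  | snoc F a G hF hG =>
    rw [nodup_labels_snoc] at hn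
    have hF := hF hn.1
    have hG := hG hn.2.1
    have h1 : ∀ j i, (j, i) ∈ F.edges → j ∈ F.labels := fun j i h =>
      ((mem_edges hn.1).1 h).1.mem.1
    have h2 : ∀ j i, (j, i) ∈ G.edges → j ∈ G.labels := fun j i h =>
      ((mem_edges hn.2.1).1 h).1.mem.1
    have hr := (nodup_roots hn.2.1).map (Prod.mk_right_injective a)
    simp only [edges, List.nodup_append]
    refine ⟨hF, ⟨hG, hr, ?_⟩, ?_⟩ <;> rintro ⟨j, i⟩ h ⟨j', i'⟩ h' <;>
      simp only [List.mem_append, List.mem_map, Prod.mk.injEq, ne_eq] at * <;> grind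

theorem word_injOn {F F' : PlaneForest α} (hn : F.labels.Nodup) (hn' : F'.labels.Nodup)
    (h : F.word = F'.word) : F = F' := by
  induction F generalizing F' with
  | nil => cases F' with
    | nil => rfl
    | snoc => simp [word] at h
  | snoc F a G hF hG => cases F' with
    | nil => simp [word] at h
    | snoc F' a' G' =>
      rw [nodup_labels_snoc] at hn hn'
      simp only [word] at h
      rw [← List.cons_append, ← List.cons_append, ← List.append_assoc, ← List.append_assoc] at h
      obtain ⟨h, ha⟩ := List.append_inj' h rfl
      obtain rfl : a = a' := by simpa using ha
      have ha : a ∉ F.word := by rw [mem_word]; exact hn.2.2.1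
      have ha' : a ∉ F'.word := by rw [mem_word]; exact hn'.2.2.1
      have ha2 : a ∉ G.word := by rw [mem_word]; exact hn.2.2.2.1
      obtain ⟨h1, h2⟩ : F.word = F'.word ∧ G.word = G'.word := by
        rcases List.append_eq_append_iff.1 h with ⟨_ | ⟨b, v⟩, h1, h2⟩ | ⟨_ | ⟨b, v⟩, h1, h2⟩
        · simp_all
        · obtain ⟨rfl, -⟩ := List.cons_eq_cons.1 h2
          simp [h1] at ha'
        · simp_all
        · obtain ⟨rfl, -⟩ := List.cons_eq_cons.1 h2
          simp [h1] at ha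
      rw [hF hn.1 hn'.1 h1, hG hn.2.1 hn'.2.1 h2]

/-- Every non-crossing word in which each letter occurs exactly twice comes from a forest. -/
theorem exists_word_eq [DecidableEq α] (w : List α) (h2 : ∀ i ∈ w, w.count i = 2)
    (hc : ∀ i j, i ≠ j → ¬ [i, j, i, j] <+ w) :
    ∃ F : PlaneForest α, F.labels.Nodup ∧ F.word = w := by
  induction hl : w.length using Nat.strong_induction_on generalizing w with
  | _ n ih =>
  rcases List.eq_nil_or_concat w with rfl | ⟨u, a, rfl⟩
  · exact ⟨nil, by simp [labels], rfl⟩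
  rw [List.concat_eq_append] at *
  have hau : a ∈ u := by
    have := h2 a (by simp)
    simp only [List.count_append, List.count_singleton_self] at this
    exact List.count_pos_iff.1 (by omega)
  obtain ⟨x, y, rfl, hax⟩ := List.eq_append_cons_of_mem hau
  have hay : a ∉ y := by
    have := h2 a (by simp)
    rw [← List.count_eq_zero]
    simp only [List.count_append, List.count_cons_self, List.count_nil] at this
    omega
  -- a letter both in `x` and in `y` would cross `a` in `w = x a y a`
  have hxy : ∀ b ∈ x, b ∉ y := by
    intro b hbx hby
    refine hc b a (fun h => hax (h ▸ hbx)) ?_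
    have h1 : [b] <+ x := by simpa using hbx
    have h2 : [b] <+ y := by simpa using hby
    simpa using h1.append ((List.cons_sublist_cons (a := a).2 h2).append (List.Sublist.refl [a]))
  obtain ⟨F, hF, hFx⟩ := ih x.length (by simp at hl; omega) x (fun i hi => by
    have := h2 i (by simp [hi])
    have h0 := List.count_eq_zero.2 (hxy i hi)
    have hne : a ≠ i := fun h => hax (h ▸ hi)
    simpa [List.count_append, List.count_cons, h0, hne] using this)
    (fun i j hij hs => hc i j hij (hs.trans (by simp))) rfl
  obtain ⟨G, hG, hGy⟩ := ih y.length (by simp at hl; omega) y (fun i hi => by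
    have := h2 i (by simp [hi])
    have h0 := List.count_eq_zero.2 (fun h => hxy i h hi)
    have hne : a ≠ i := fun h => hay (h ▸ hi)
    simpa [List.count_append, List.count_cons, h0, hne] using this)
    (fun i j hij hs => hc i j hij (hs.trans (((List.sublist_cons_self _ _).trans
      (List.sublist_append_right _ _)).trans (List.sublist_append_left _ _)))) rfl
  subst hFx hGy
  refine ⟨snoc F a G, nodup_labels_snoc.2 ⟨hF, hG, ?_, ?_, ?_⟩, by simp [word]⟩
  · rwa [mem_word] at hax
  · rwa [mem_word] at hay
  · simpa only [mem_word] using hxy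

end PlaneForest

/-! ### Ordered non-crossing pairings as labelled plane forests -/

open scoped List

theorem List.count_ofFn_eq_card {n : ℕ} {α : Type*} [DecidableEq α] (f : Fin n → α) (i : α) :
    (List.ofFn f).count i = (Finset.univ.filter fun x => f x = i).card := by
  rw [List.ofFn_eq_map, List.count, List.countP_map, List.countP_eq_length_filter]
  simp only [Finset.card, Finset.filter, Fin.univ_def, Multiset.filter_coe, Multiset.coe_card]
  congr 1

theorem List.quad_sublist_ofFn {n : ℕ} {α : Type*} (f : Fin n → α) (a b c d : α) :
    [a, b, c, d] <+ List.ofFn f ↔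
      ∃ x y z t, x < y ∧ y < z ∧ z < t ∧ f x = a ∧ f y = b ∧ f z = c ∧ f t = d := by
  rw [List.ofFn_eq_map]
  constructor
  · intro h
    obtain ⟨l, hl, he⟩ := List.sublist_map_iff.1 h
    have hp : l.Pairwise (· < ·) := (List.pairwise_lt_finRange n).sublist hl
    match l, he, hp with
    | [x, y, z, t], he, hp =>
      simp only [List.map_cons, List.map_nil, List.cons.injEq, and_true] at he
      simp only [List.pairwise_cons, List.mem_cons] at hp
      refine ⟨x, y, z, t, ?_, ?_, ?_, ?_⟩ <;> grind
  · rintro ⟨x, y, z, t, h1, h2, h3, rfl, rfl, rfl, rfl⟩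
    refine List.Sublist.map (l₁ := [x, y, z, t]) f ?_
    refine List.sublist_of_subperm_of_pairwise (r := (· < ·)) ?_ ?_ (List.pairwise_lt_finRange n)
    · refine List.subperm_of_subset ?_ fun x _ => List.mem_finRange x
      have := h1.trans h2
      have := h2.trans h3
      have := h1.trans (h2.trans h3)
      simp only [List.nodup_cons, List.mem_cons]
      grind
    · have := h1.trans h2
      have := h2.trans h3
      have := h1.trans (h2.trans h3)
      simp only [List.pairwise_cons, List.mem_cons]
      grind

namespace OrdPart

variable {n b : ℕ}

/-- The blocks of the partition of the positions of a word according to their letters. -/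
def fibers (f : Fin n → Fin b) (i : Fin b) : Finset (Fin n) :=
  Finset.univ.filter fun x => f x = i

theorem mem_fibers {f : Fin n → Fin b} {i : Fin b} {x : Fin n} : x ∈ fibers f i ↔ f x = i := by
  simp [fibers]

theorem isPairing_fibers {f : Fin n → Fin b} :
    IsPairing (fibers f) ↔ ∀ i, (List.ofFn f).count i = 2 := by
  simp only [IsPairing, List.count_ofFn_eq_card, fibers]

theorem isNonCrossing_fibers {f : Fin n → Fin b} :
    IsNonCrossing (fibers f) ↔ ∀ i j, i ≠ j → ¬ [i, j, i, j] <+ List.ofFn f := by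
  simp only [IsNonCrossing, List.quad_sublist_ofFn, mem_fibers]
  constructor
  · rintro h i j hij ⟨x, y, z, t, h1, h2, h3, hx, hy, hz, ht⟩
    exact h i j hij x hx z hz y hy t ht ⟨h1, h2, h3⟩
  · rintro h i j hij x hx z hz y hy t ht ⟨h1, h2, h3⟩
    exact h i j hij ⟨x, y, z, t, h1, h2, h3, hx, hy, hz, ht⟩

theorem isOrderedPartition_fibers {f : Fin n → Fin b} (h : IsPairing (fibers f)) :
    IsOrderedPartition (fibers f) := by
  refine ⟨fun i => ?_, fun i j hij => ?_, fun x => ⟨f x, mem_fibers.2 rfl⟩⟩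
  · rw [← Finset.card_pos, h i]; norm_num
  · rw [Finset.disjoint_left]
    intro x hx hx'
    rw [mem_fibers] at hx hx'
    exact hij (hx.symm.trans hx')

theorem exists_fibers_eq {P : Fin b → Finset (Fin n)} (h : IsOrderedPartition P) :
    ∃ f : Fin n → Fin b, fibers f = P := by
  choose f hf using h.2.2
  refine ⟨f, funext fun i => Finset.ext fun x => ?_⟩
  rw [mem_fibers]
  refine ⟨fun hx => hx ▸ hf x, fun hx => ?_⟩
  by_contra hne
  exact Finset.disjoint_left.1 (h.2.1 _ _ hne) (hf x) hx

theorem outer_fibers {f : Fin n → Fin b} (h : IsPairing (fibers f)) {j i : Fin b} :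
    Outer (fibers f) j i ↔ i ≠ j ∧ [j, i, i, j] <+ List.ofFn f := by
  rw [Outer, List.quad_sublist_ofFn]
  refine and_congr_right fun hij => ?_
  obtain ⟨c, d, hcd, hc⟩ := Finset.card_eq_two.1 (h i)
  rw [hc]
  have hm : ∀ x, f x = i ↔ x = c ∨ x = d := fun x => by
    rw [← mem_fibers, hc]; simp
  simp only [mem_fibers]
  constructor
  · rintro ⟨x, hx, y, hy, hxy⟩
    have h1 := hxy c (by simp)
    have h2 := hxy d (by simp)
    rcases lt_or_gt_of_ne hcd with hlt | hlt
    · exact ⟨x, c, d, y, h1.1, hlt, h2.2, hx, (hm c).2 (by simp), (hm d).2 (by simp), hy⟩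
    · exact ⟨x, d, c, y, h2.1, hlt, h1.2, hx, (hm d).2 (by simp), (hm c).2 (by simp), hy⟩
  · rintro ⟨x, y, z, t, h1, h2, h3, hx, hy, hz, ht⟩
    refine ⟨x, hx, t, ht, fun u hu => ?_⟩
    rw [hm] at hy hz
    simp only [Finset.mem_insert, Finset.mem_singleton] at hu
    grind

end OrdPart

namespace PlaneForest

variable {α : Type*}

/-- The product of `w (label of a node) (label of its child)` over all edges. -/
def weight (w : α → α → ℝ) (F : PlaneForest α) : ℝ :=
  (F.edges.map fun e => w e.1 e.2).prod

theorem weight_nil (w : α → α → ℝ) : (nil : PlaneForest α).weight w = 1 := by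
  simp [weight, edges]

theorem weight_snoc (w : α → α → ℝ) (F : PlaneForest α) (a : α) (G : PlaneForest α) :
    (snoc F a G).weight w = F.weight w * (G.weight w * (G.roots.map (w a)).prod) := by
  simp [weight, edges, Function.comp_def]

theorem finite_setOf_labels_eq [Finite α] (L : Finset α) :
    {F : PlaneForest α | F.labels.Nodup ∧ ∀ i, i ∈ F.labels ↔ i ∈ L}.Finite := by
  classical
  refine Set.Finite.of_finite_image (f := word) ?_ fun F hF F' hF' h => word_injOn hF.1 hF'.1 h
  refine (List.finite_length_eq α (2 * L.card)).subset ?_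
  rintro _ ⟨F, hF, rfl⟩
  rw [Set.mem_ofPred_eq, length_word, ← List.toFinset_card_of_nodup hF.1]
  congr 2
  ext i
  rw [List.mem_toFinset, hF.2]

/-- The plane forests whose nodes carry the labels in `L`, each one once. -/
noncomputable def withLabels [Finite α] (L : Finset α) : Finset (PlaneForest α) :=
  (finite_setOf_labels_eq L).toFinset

theorem mem_withLabels [Finite α] {L : Finset α} {F : PlaneForest α} :
    F ∈ withLabels L ↔ F.labels.Nodup ∧ ∀ i, i ∈ F.labels ↔ i ∈ L := by
  simp [withLabels]

variable {k : ℕ}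

theorem length_word_of_mem {F : PlaneForest (Fin k)} (hF : F ∈ withLabels Finset.univ) :
    F.word.length = 2 * k := by
  rw [mem_withLabels] at hF
  rw [length_word, ← List.toFinset_card_of_nodup hF.1]
  have : F.labels.toFinset = Finset.univ := by ext i; simp [hF.2]
  simp [this]

/-- The blocks of the pairing of `n` points defined by the word of a forest. -/
def blocks (n : ℕ) (F : PlaneForest (Fin k)) (i : Fin k) : Finset (Fin n) :=
  Finset.univ.filter fun x => F.word[(x : ℕ)]? = some i

theorem exists_ofFn_eq_word {n : ℕ} {F : PlaneForest (Fin k)} (hF : F.word.length = n) :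
    ∃ f : Fin n → Fin k, List.ofFn f = F.word ∧ F.blocks n = OrdPart.fibers f := by
  subst hF
  refine ⟨F.word.get, List.ofFn_get _, ?_⟩
  ext i x
  simp [blocks, OrdPart.fibers]

theorem isPairing_of_ofFn {n : ℕ} {F : PlaneForest (Fin k)} (hF : F ∈ withLabels Finset.univ)
    {f : Fin n → Fin k} (hf : List.ofFn f = F.word) : OrdPart.IsPairing (OrdPart.fibers f) := by
  rw [mem_withLabels] at hF
  rw [OrdPart.isPairing_fibers, hf]
  intro i
  rw [count_word, List.count_eq_one_of_mem hF.1 ((hF.2 i).2 (Finset.mem_univ _))]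

theorem blocks_mem_ONC2 {F : PlaneForest (Fin k)} (hF : F ∈ withLabels Finset.univ) :
    F.blocks (2 * k) ∈ OrdPart.ONC2 k := by
  obtain ⟨f, hf, hb⟩ := exists_ofFn_eq_word (length_word_of_mem hF)
  have h2 := isPairing_of_ofFn hF hf
  rw [hb, OrdPart.ONC2, Finset.mem_filter]
  refine ⟨Finset.mem_univ _, OrdPart.isOrderedPartition_fibers h2, ?_, h2⟩
  rw [OrdPart.isNonCrossing_fibers, hf]
  exact fun i j hij => not_crossing_word (mem_withLabels.1 hF).1 hij

theorem blocks_injOn {F F' : PlaneForest (Fin k)} (hF : F ∈ withLabels Finset.univ)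
    (hF' : F' ∈ withLabels Finset.univ) (h : F.blocks (2 * k) = F'.blocks (2 * k)) : F = F' := by
  obtain ⟨f, hf, hb⟩ := exists_ofFn_eq_word (length_word_of_mem hF)
  obtain ⟨f', hf', hb'⟩ := exists_ofFn_eq_word (length_word_of_mem hF')
  refine word_injOn (mem_withLabels.1 hF).1 (mem_withLabels.1 hF').1 ?_
  rw [← hf, ← hf']
  congr 1
  ext x : 1
  rw [hb, hb'] at h
  exact (OrdPart.mem_fibers.1 (h ▸ OrdPart.mem_fibers.2 rfl)).symm

theorem exists_blocks_eq {P : Fin k → Finset (Fin (2 * k))} (hP : P ∈ OrdPart.ONC2 k) :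
    ∃ F ∈ withLabels Finset.univ, F.blocks (2 * k) = P := by
  rw [OrdPart.ONC2, Finset.mem_filter] at hP
  obtain ⟨-, hp, hc, h2⟩ := hP
  obtain ⟨f, rfl⟩ := OrdPart.exists_fibers_eq hp
  rw [OrdPart.isPairing_fibers] at h2
  obtain ⟨F, hF, hw⟩ := exists_word_eq (List.ofFn f) (fun i _ => h2 i)
    (OrdPart.isNonCrossing_fibers.1 hc)
  have hm : F ∈ withLabels Finset.univ := by
    refine mem_withLabels.2 ⟨hF, fun i => ?_⟩
    rw [← mem_word, hw]
    exact iff_of_true (List.count_pos_iff.1 (by rw [h2 i]; norm_num)) (Finset.mem_univ _)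
  refine ⟨F, hm, ?_⟩
  obtain ⟨f', hf', hb'⟩ := exists_ofFn_eq_word (length_word_of_mem hm)
  rw [hb', List.ofFn_injective (hf'.trans hw)]

theorem covers_blocks {F : PlaneForest (Fin k)} (hF : F ∈ withLabels Finset.univ) {j i : Fin k} :
    OrdPart.Covers (F.blocks (2 * k)) j i ↔ (j, i) ∈ F.edges := by
  obtain ⟨f, hf, hb⟩ := exists_ofFn_eq_word (length_word_of_mem hF)
  have h2 := isPairing_of_ofFn hF hf
  have hn := (mem_withLabels.1 hF).1
  have ho : ∀ j i, OrdPart.Outer (F.blocks (2 * k)) j i ↔ F.Anc j i := fun j i => by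
    rw [hb, OrdPart.outer_fibers h2, hf, anc_iff_sublist hn]
  have hne : ∀ j i, F.Anc j i → i ≠ j := fun j i h => h.ne hn
  simp only [OrdPart.Covers, ho, mem_edges hn]
  grind

theorem pow_disorders_mul_pow_orders {F : PlaneForest (Fin k)} (hF : F ∈ withLabels Finset.univ)
    (p q : ℝ) :
    p ^ OrdPart.disorders (F.blocks (2 * k)) * q ^ OrdPart.orders (F.blocks (2 * k)) =
      F.weight fun a c => if c < a then p else q := by
  have hn := nodup_edges (mem_withLabels.1 hF).1
  have hd : OrdPart.disorders (F.blocks (2 * k)) =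
      (F.edges.toFinset.filter fun e => e.2 < e.1).card := by
    rw [OrdPart.disorders]
    refine Finset.card_bij' (fun x _ => x.swap) (fun x _ => x.swap) ?_ ?_ ?_ ?_ <;>
      simp +contextual [covers_blocks hF]
  have ho : OrdPart.orders (F.blocks (2 * k)) =
      (F.edges.toFinset.filter fun e => ¬ e.2 < e.1).card := by
    rw [OrdPart.orders]
    congr 1
    ext ⟨j, i⟩
    simp only [Finset.mem_filter, Finset.mem_univ, true_and, covers_blocks hF, List.mem_toFinset]
    have : (j, i) ∈ F.edges → i ≠ j := fun h =>
      ((mem_edges (mem_withLabels.1 hF).1).1 h).1.ne (mem_withLabels.1 hF).1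
    grind
  rw [hd, ho, weight, ← List.prod_toFinset _ hn, Finset.prod_ite, Finset.prod_const,
    Finset.prod_const]

/-- The sum over ordered non-crossing pairings as a sum over labelled plane forests. -/
theorem sum_ONC2 (p q : ℝ) (k : ℕ) :
    ∑ P ∈ OrdPart.ONC2 k, p ^ OrdPart.disorders P * q ^ OrdPart.orders P =
      ∑ F ∈ withLabels (Finset.univ : Finset (Fin k)),
        F.weight fun a c => if c < a then p else q :=
  (Finset.sum_bij (fun F _ => F.blocks (2 * k)) (fun _ hF => blocks_mem_ONC2 hF)
    (fun _ hF _ hF' h => blocks_injOn hF hF' h)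
    (fun _ hP => by simpa using exists_blocks_eq hP)
    (fun _ hF => (pow_disorders_mul_pow_orders hF p q).symm)).symm

end PlaneForest

/-! ### Counting labelled plane forests -/

namespace PlaneForest

/-- The product of exponential generating functions. -/
theorem sum_powerset_factorial_mul {α : Type*} [DecidableEq α] (L : Finset α) (f g : ℕ → ℝ) :
    ∑ M ∈ L.powerset, (M.card.factorial * f M.card) *
        ((L \ M).card.factorial * g (L \ M).card) =
      L.card.factorial * ∑ ij ∈ Finset.HasAntidiagonal.antidiagonal L.card, f ij.1 * g ij.2 := by
  have h0 := Finset.sum_powerset_apply_card (fun m : ℕ => ((m.factorial : ℝ) * f m) *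
    ((L.card - m).factorial * g (L.card - m))) (x := L)
  rw [Finset.sum_congr rfl fun M hM => by
      rw [Finset.card_sdiff_of_subset (Finset.mem_powerset.1 hM)], h0,
    Finset.Nat.sum_antidiagonal_eq_sum_range_succ_mk,
    Finset.mul_sum]
  refine Finset.sum_congr rfl fun m hm => ?_
  have h := Nat.choose_mul_factorial_mul_factorial (Nat.lt_succ_iff.1 (Finset.mem_range.1 hm))
  rw [← h, nsmul_eq_mul]
  push_cast
  ring

/-- The number of labelled plane trees with `n` nodes, counted with weight `c` for each edge and
divided by `n!`: there are `n! * catalan (n - 1)` such trees, each with `n - 1` edges. -/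
noncomputable def treeCoeff (c : ℝ) (n : ℕ) : ℝ :=
  if n = 0 then 0 else c ^ (n - 1) * catalan (n - 1)

theorem treeCoeff_eq (c : ℝ) (n : ℕ) :
    treeCoeff c n = (if n = 1 then 1 else 0) +
      c * ∑ ij ∈ Finset.HasAntidiagonal.antidiagonal n, treeCoeff c ij.1 * treeCoeff c ij.2 := by
  match n with
  | 0 => simp [treeCoeff]
  | 1 => simp [treeCoeff, Finset.Nat.antidiagonal_succ]
  | n + 2 =>
    rw [Finset.Nat.sum_antidiagonal_succ, Finset.Nat.sum_antidiagonal_succ']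
    have h : ∀ m, treeCoeff c (m + 1) = c ^ m * catalan m := fun m => by simp [treeCoeff]
    have h0 : treeCoeff c 0 = 0 := by simp [treeCoeff]
    simp only [h, h0, catalan_succ', mul_zero, zero_mul, zero_add, Nat.cast_sum,
      Nat.cast_mul]
    rw [Finset.mul_sum]
    rw [if_neg (by omega), zero_add]
    rw [Finset.mul_sum]
    refine Finset.sum_congr rfl fun ij hij => ?_
    rw [← Finset.HasAntidiagonal.mem_antidiagonal.1 hij]
    ring

variable {α : Type*} [Finite α] [DecidableEq α]

/-- The plane trees whose nodes carry the labels in `L`, each one once. A tree is given by the label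
of its root and the forest below the root. -/
noncomputable def treesWithLabels (L : Finset α) : Finset (Σ _ : α, PlaneForest α) :=
  L.sigma fun a => withLabels (L.erase a)

/-- The product of `w (label of a node) (label of its child)` over all edges of a tree. -/
def treeWeight {α : Type*} (w : α → α → ℝ) (x : Σ _ : α, PlaneForest α) : ℝ :=
  x.2.weight w * (x.2.roots.map (w x.1)).prod

theorem mem_treesWithLabels {L : Finset α} {x : Σ _ : α, PlaneForest α} :
    x ∈ treesWithLabels L ↔
      x.2.labels.Nodup ∧ x.1 ∉ x.2.labels ∧ ∀ i, i ∈ L ↔ i = x.1 ∨ i ∈ x.2.labels := by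
  simp only [treesWithLabels, Finset.mem_sigma, mem_withLabels, Finset.mem_erase]
  grind

theorem nil_mem_withLabels {α : Type*} [Finite α] {L : Finset α} : nil ∈ withLabels L ↔ L = ∅ := by
  simp only [mem_withLabels, labels, Finset.eq_empty_iff_forall_notMem]
  simp

theorem snoc_mem_withLabels {L : Finset α} {F G : PlaneForest α} {a : α} :
    snoc F a G ∈ withLabels L ↔
      ∃ M ⊆ L, F ∈ withLabels M ∧ (⟨a, G⟩ : Σ _ : α, PlaneForest α) ∈ treesWithLabels (L \ M) := by
  simp only [mem_withLabels, nodup_labels_snoc, mem_treesWithLabels]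
  simp only [labels, List.mem_append, List.mem_cons, Finset.mem_sdiff]
  constructor
  · rintro ⟨h, h'⟩
    refine ⟨F.labels.toFinset, fun i => ?_, ?_⟩ <;> simp only [List.mem_toFinset] <;> grind
  · rintro ⟨M, hM, h1, h2⟩
    have := @hM
    grind

theorem mk_snoc_mem_treesWithLabels {L : Finset α} {F G : PlaneForest α} {a c : α} :
    (⟨a, snoc F c G⟩ : Σ _ : α, PlaneForest α) ∈ treesWithLabels L ↔
      ∃ M ⊆ L, (⟨a, F⟩ : Σ _ : α, PlaneForest α) ∈ treesWithLabels M ∧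
        (⟨c, G⟩ : Σ _ : α, PlaneForest α) ∈ treesWithLabels (L \ M) := by
  simp only [mem_treesWithLabels, nodup_labels_snoc]
  simp only [labels, List.mem_append, List.mem_cons, Finset.mem_sdiff]
  constructor
  · rintro ⟨h, h', h''⟩
    refine ⟨insert a F.labels.toFinset, fun i => ?_, ?_⟩ <;>
      simp only [Finset.mem_insert, List.mem_toFinset] <;> grind
  · rintro ⟨M, hM, h1, h2⟩
    have := @hM
    grind

/-- Splitting off the last tree of a non-empty forest. -/
theorem sum_weight_withLabels (w : α → α → ℝ) (L : Finset α) :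
    ∑ F ∈ withLabels L, F.weight w = (if L.card = 0 then 1 else 0) +
      ∑ M ∈ L.powerset, (∑ F ∈ withLabels M, F.weight w) *
        ∑ x ∈ treesWithLabels (L \ M), treeWeight w x := by
  classical
  rw [← Finset.sum_filter_add_sum_filter_not _ (fun F => F = nil)]
  congr 1
  · have : (withLabels L).filter (fun F => F = nil) = if nil ∈ withLabels L then {nil} else ∅ := by
      split_ifs with h <;> ext F <;> grind
    rw [this]
    simp only [nil_mem_withLabels, Finset.card_eq_zero]
    split <;> simp [weight_nil]
  · simp only [Finset.sum_mul_sum, ← Finset.sum_product', Finset.sum_sigma']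
    symm
    refine Finset.sum_bij (fun z _ => snoc z.2.1 z.2.2.1 z.2.2.2) ?_ ?_ ?_ ?_
    · rintro ⟨M, F, a, G⟩ hz
      simp only [Finset.mem_sigma, Finset.mem_powerset, Finset.mem_product] at hz
      simp only [Finset.mem_filter, reduceCtorEq, not_false_eq_true, and_true]
      exact snoc_mem_withLabels.2 ⟨M, hz⟩
    · rintro ⟨M, F, a, G⟩ hz ⟨M', F', a', G'⟩ hz' h
      simp only [Finset.mem_sigma, Finset.mem_powerset, Finset.mem_product, mem_withLabels]
        at hz hz'
      simp only [snoc.injEq] at h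
      obtain ⟨rfl, rfl, rfl⟩ := h
      obtain rfl : M = M' := Finset.ext fun i => by rw [← hz.2.1.2, ← hz'.2.1.2]
      rfl
    · rintro (_ | ⟨F, a, G⟩) hF
      · simp at hF
      · obtain ⟨M, h⟩ := snoc_mem_withLabels.1 (Finset.mem_filter.1 hF).1
        refine ⟨⟨M, F, a, G⟩, ?_, rfl⟩
        simpa only [Finset.mem_sigma, Finset.mem_powerset, Finset.mem_product] using h
    · rintro ⟨M, F, a, G⟩ -
      rw [weight_snoc, treeWeight]

/-- Splitting off the last subtree of the root. -/
theorem sum_treeWeight_aux (w : α → α → ℝ) (L : Finset α) :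
    ∑ x ∈ treesWithLabels L, treeWeight w x = (if L.card = 1 then 1 else 0) +
      ∑ M ∈ L.powerset, ∑ x ∈ treesWithLabels M, ∑ y ∈ treesWithLabels (L \ M),
        treeWeight w x * treeWeight w y * w x.1 y.1 := by
  classical
  rw [← Finset.sum_filter_add_sum_filter_not _ (fun x => x.2 = nil)]
  congr 1
  · split_ifs with h
    · obtain ⟨a, rfl⟩ := Finset.card_eq_one.1 h
      have : (treesWithLabels {a}).filter (fun x => x.2 = nil) = {⟨a, nil⟩} := by
        ext ⟨b, F⟩
        simp only [Finset.mem_filter, mem_treesWithLabels, Finset.mem_singleton, Sigma.mk.injEq,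
          heq_eq_eq]
        constructor
        · rintro ⟨⟨-, -, h⟩, hF⟩
          exact ⟨((h b).2 (Or.inl rfl)), hF⟩
        · rintro ⟨rfl, rfl⟩
          simp [labels]
      simp [this, treeWeight, weight_nil, roots]
    · refine Finset.sum_eq_zero fun x hx => absurd ?_ h
      rw [Finset.mem_filter, mem_treesWithLabels] at hx
      refine Finset.card_eq_one.2 ⟨x.1, Finset.ext fun i => ?_⟩
      rw [hx.1.2.2, hx.2]
      simp [labels]
  · simp only [← Finset.sum_product', Finset.sum_sigma']
    symm
    refine Finset.sum_bij (fun z _ => ⟨z.2.1.1, snoc z.2.1.2 z.2.2.1 z.2.2.2⟩) ?_ ?_ ?_ ?_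
    · rintro ⟨M, ⟨a, F⟩, c, G⟩ hz
      simp only [Finset.mem_sigma, Finset.mem_powerset, Finset.mem_product] at hz
      simp only [Finset.mem_filter, reduceCtorEq, not_false_eq_true, and_true]
      exact mk_snoc_mem_treesWithLabels.2 ⟨M, hz⟩
    · rintro ⟨M, ⟨a, F⟩, c, G⟩ hz ⟨M', ⟨a', F'⟩, c', G'⟩ hz' h
      simp only [Finset.mem_sigma, Finset.mem_powerset, Finset.mem_product, mem_treesWithLabels]
        at hz hz'
      simp only [Sigma.mk.injEq, snoc.injEq, heq_eq_eq] at h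
      obtain ⟨rfl, rfl, rfl, rfl⟩ := h
      obtain rfl : M = M' := Finset.ext fun i => by rw [hz.2.1.2.2, hz'.2.1.2.2]
      rfl
    · rintro ⟨a, _ | ⟨F, c, G⟩⟩ hF
      · simp at hF
      · obtain ⟨M, h⟩ := mk_snoc_mem_treesWithLabels.1 (Finset.mem_filter.1 hF).1
        refine ⟨⟨M, ⟨a, F⟩, c, G⟩, ?_, rfl⟩
        simpa only [Finset.mem_sigma, Finset.mem_powerset, Finset.mem_product] using h
    · rintro ⟨M, ⟨a, F⟩, c, G⟩ -
      simp only [treeWeight, weight_snoc, roots, List.map_append, List.prod_append, List.map_cons,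
        List.map_nil, List.prod_singleton]
      ring

/-- Hanging the second tree below the root of the first, or the first below the root of the second:
the two results are exchanged by a bijection, so that only `w a c + w c a` matters. -/
theorem sum_treeWeight {w : α → α → ℝ} {s : ℝ} (hw : ∀ a c, a ≠ c → w a c + w c a = s)
    (L : Finset α) :
    ∑ x ∈ treesWithLabels L, treeWeight w x = (if L.card = 1 then 1 else 0) +
      s / 2 * ∑ M ∈ L.powerset, (∑ x ∈ treesWithLabels M, treeWeight w x) *
        ∑ y ∈ treesWithLabels (L \ M), treeWeight w y := by
  rw [sum_treeWeight_aux]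
  congr 1
  set Z := ∑ M ∈ L.powerset, ∑ x ∈ treesWithLabels M, ∑ y ∈ treesWithLabels (L \ M),
        treeWeight w x * treeWeight w y * w x.1 y.1 with hZ
  have hZ' : Z = ∑ M ∈ L.powerset, ∑ x ∈ treesWithLabels M, ∑ y ∈ treesWithLabels (L \ M),
        treeWeight w x * treeWeight w y * w y.1 x.1 := by
    refine Finset.sum_bij' (fun M _ => L \ M) (fun M _ => L \ M) (by simp) (by simp) ?_ ?_ ?_
    · intro M hM
      exact sdiff_sdiff_eq_self (Finset.mem_powerset.1 hM)
    · intro M hM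
      exact sdiff_sdiff_eq_self (Finset.mem_powerset.1 hM)
    · intro M hM
      rw [Finset.sum_comm]
      have : L \ (L \ M) = M := sdiff_sdiff_eq_self (Finset.mem_powerset.1 hM)
      rw [this]
      exact Finset.sum_congr rfl fun y _ => Finset.sum_congr rfl fun x _ => by ring
  have h2 : Z + Z = s * ∑ M ∈ L.powerset, (∑ x ∈ treesWithLabels M, treeWeight w x) *
        ∑ y ∈ treesWithLabels (L \ M), treeWeight w y := by
    nth_rewrite 2 [hZ']
    rw [hZ, ← Finset.sum_add_distrib, Finset.mul_sum]
    refine Finset.sum_congr rfl fun M _ => ?_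
    rw [Finset.sum_mul_sum, Finset.mul_sum, ← Finset.sum_add_distrib]
    refine Finset.sum_congr rfl fun x hx => ?_
    rw [Finset.mul_sum, ← Finset.sum_add_distrib]
    refine Finset.sum_congr rfl fun y hy => ?_
    have hxM := ((mem_treesWithLabels.1 hx).2.2 x.1).2 (Or.inl rfl)
    have hyM := ((mem_treesWithLabels.1 hy).2.2 y.1).2 (Or.inl rfl)
    rw [← hw x.1 y.1 (fun h => (Finset.mem_sdiff.1 hyM).2 (h ▸ hxM))]
    ring
  linarith

theorem sum_treeWeight_eq {w : α → α → ℝ} {s : ℝ} (hw : ∀ a c, a ≠ c → w a c + w c a = s)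
    (L : Finset α) :
    ∑ x ∈ treesWithLabels L, treeWeight w x = L.card.factorial * treeCoeff (s / 2) L.card := by
  induction L using Finset.strongInduction with
  | _ L ih =>
  have h0 : treesWithLabels (∅ : Finset α) = ∅ := by simp [treesWithLabels]
  have hc0 : treeCoeff (s / 2) 0 = 0 := by simp [treeCoeff]
  rw [sum_treeWeight hw, treeCoeff_eq, mul_add, mul_left_comm, ← sum_powerset_factorial_mul]
  congr 1
  · split_ifs with h <;> simp [h]
  · congr 1
    refine Finset.sum_congr rfl fun M hM => ?_
    rw [Finset.mem_powerset] at hM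
    rcases eq_or_ne M L with rfl | hne
    · simp [h0, hc0]
    rcases eq_or_ne M ∅ with rfl | hne'
    · simp [h0, hc0]
    rw [ih M (hM.ssubset_of_ne hne), ih (L \ M) (Finset.sdiff_ssubset hM
      (Finset.nonempty_iff_ne_empty.2 hne'))]

/-- The generating function of `r` is `1 / (1 - B)`, with `B` that of the trees. -/
theorem sum_weight_eq {w : α → α → ℝ} {s : ℝ} (hw : ∀ a c, a ≠ c → w a c + w c a = s)
    {r : ℕ → ℝ} (hr : ∀ n, r n = (if n = 0 then 1 else 0) +
      ∑ ij ∈ Finset.HasAntidiagonal.antidiagonal n, r ij.1 * treeCoeff (s / 2) ij.2)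
    (L : Finset α) :
    ∑ F ∈ withLabels L, F.weight w = L.card.factorial * r L.card := by
  induction L using Finset.strongInduction with
  | _ L ih =>
  have h0 : treesWithLabels (∅ : Finset α) = ∅ := by simp [treesWithLabels]
  have hc0 : treeCoeff (s / 2) 0 = 0 := by simp [treeCoeff]
  rw [sum_weight_withLabels, hr, mul_add, ← sum_powerset_factorial_mul]
  congr 1
  · split_ifs with h <;> simp [h]
  · refine Finset.sum_congr rfl fun M hM => ?_
    rw [Finset.mem_powerset] at hM
    rcases eq_or_ne M L with rfl | hne
    · simp [h0, hc0]
    rw [ih M (hM.ssubset_of_ne hne), sum_treeWeight_eq hw]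

end PlaneForest

open PowerSeries in
theorem kestenR_eq_coeff (p q : ℝ) (k : ℕ) :
    kestenR p q k = coeff k (1 - mk (PlaneForest.treeCoeff ((p + q) / 2)))⁻¹ := by
  set B : ℝ⟦X⟧ := mk (PlaneForest.treeCoeff ((p + q) / 2)) with hB
  have hc : constantCoeff (1 - B) ≠ 0 := by
    rw [map_sub, ← coeff_zero_eq_constantCoeff_apply B, hB, coeff_mk]
    simp [PlaneForest.treeCoeff]
  have hR := PowerSeries.inv_mul_cancel _ hc
  have hr : ∀ n, coeff n (1 - B)⁻¹ = (if n = 0 then 1 else 0) +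
      ∑ ij ∈ Finset.HasAntidiagonal.antidiagonal n, coeff ij.1 (1 - B)⁻¹ *
        PlaneForest.treeCoeff ((p + q) / 2) ij.2 := fun n => by
    have h : (1 - B)⁻¹ = 1 + (1 - B)⁻¹ * B := by linear_combination hR
    nth_rewrite 1 [h]
    simp only [map_add, coeff_one, coeff_mul, hB, coeff_mk]
  rw [kestenR, PlaneForest.sum_ONC2, PlaneForest.sum_weight_eq (s := p + q) _ hr]
  · rw [Finset.card_univ, Fintype.card_fin]
    field_simp
  · intro a c hac
    rcases lt_or_gt_of_ne hac with h | h
    · simp only [not_lt.2 h.le, h, if_true, if_false]; ring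
    · simp only [not_lt.2 h.le, h, if_true, if_false]

theorem kestenR_zero (p q : ℝ) : kestenR p q 0 = 1 := by
  rw [kestenR_eq_coeff, PowerSeries.coeff_zero_eq_constantCoeff_apply,
    PowerSeries.constantCoeff_inv,
    map_sub, ← PowerSeries.coeff_zero_eq_constantCoeff_apply,
    ← PowerSeries.coeff_zero_eq_constantCoeff_apply, PowerSeries.coeff_mk]
  simp [PlaneForest.treeCoeff]

open PowerSeries in
/-- With `c = (p + q) / 2` the generating function `R` of `r` and that of the trees `B` satisfy
`B = X + c B ^ 2` and `R (1 - B) = 1`, hence `X R - (1 - c) (R - 1) = c B`. -/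
theorem kestenR_sub (p q : ℝ) (k : ℕ) :
    kestenR p q k - (1 - (p + q) / 2) * kestenR p q (k + 1) =
      ((p + q) / 2) ^ (k + 1) * catalan k := by
  simp only [kestenR_eq_coeff]
  set c := (p + q) / 2
  set B : ℝ⟦X⟧ := mk (PlaneForest.treeCoeff c) with hB
  have hc : constantCoeff (1 - B) ≠ 0 := by
    rw [map_sub, ← coeff_zero_eq_constantCoeff_apply B, hB, coeff_mk]
    simp [PlaneForest.treeCoeff]
  have hR := PowerSeries.inv_mul_cancel _ hc
  set R := (1 - B)⁻¹
  have hBB : B = X + C c * (B * B) := by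
    ext n
    rw [map_add, coeff_C_mul, coeff_mul, coeff_X, hB, coeff_mk, PlaneForest.treeCoeff_eq]
    simp only [coeff_mk]
  have h : X * R - C (1 - c) * (R - 1) = C c * B := by
    rw [map_sub, map_one]
    linear_combination (-R) * hBB + (C c * B - (1 - C c)) * hR
  have h := congrArg (coeff (k + 1)) h
  rw [map_sub, coeff_succ_X_mul, coeff_C_mul, coeff_C_mul, map_sub, coeff_one,
    if_neg (Nat.succ_ne_zero k), sub_zero, hB, coeff_mk, PlaneForest.treeCoeff,
    if_neg (Nat.succ_ne_zero k)] at h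
  rw [h, Nat.add_sub_cancel]
  ring

/-! ### Trigonometric integrals -/

open Real in
theorem integral_cos_natCast_mul {m : ℕ} (hm : m ≠ 0) : ∫ t in (0 : ℝ)..π, cos (m * t) = 0 := by
  have : (m : ℝ) ≠ 0 := by exact_mod_cast hm
  rw [intervalIntegral.integral_comp_mul_left _ this, integral_cos]
  simp [sin_nat_mul_pi]

open Real in
theorem integral_sin_mul_sin_succ_mul (n : ℕ) :
    ∫ t in (0 : ℝ)..π, sin t * sin ((n + 1) * t) = if n = 0 then π / 2 else 0 := by
  have h : ∀ t : ℝ, sin t * sin ((n + 1) * t) =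
      (cos (n * t) - cos (((n + 2 : ℕ) : ℝ) * t)) / 2 := by
    intro t
    have h1 : (n : ℝ) * t = (n + 1) * t - t := by ring
    have h2 : ((n + 2 : ℕ) : ℝ) * t = (n + 1) * t + t := by push_cast; ring
    rw [h1, h2, cos_sub, cos_add]
    ring
  simp_rw [h]
  rw [intervalIntegral.integral_div, intervalIntegral.integral_sub
    (by apply Continuous.intervalIntegrable; fun_prop)
    (by apply Continuous.intervalIntegrable; fun_prop),
    integral_cos_natCast_mul (m := n + 2) (by omega)]
  split_ifs with hn
  · simp [hn]
  · rw [integral_cos_natCast_mul hn]; simp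

open Complex in
theorem one_sub_mul_exp_mul (w : ℂ) (t : ℝ) :
    (1 - w * exp (t * I)) * (1 - w * exp (-(t * I))) = 1 - 2 * w * Real.cos t + w ^ 2 := by
  have h1 : exp (t * I) * exp (-(t * I)) = 1 := by rw [← exp_add]; simp
  rw [ofReal_cos, Complex.cos, neg_mul]
  linear_combination w ^ 2 * h1

open Complex in
theorem one_sub_two_mul_cos_add_sq_ne_zero {w : ℂ} (hw : ‖w‖ < 1) (t : ℝ) :
    1 - 2 * w * Real.cos t + w ^ 2 ≠ 0 := by
  have h : ∀ s : ℝ, 1 - w * exp (s * I) ≠ 0 := fun s h => by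
    have := congrArg norm (sub_eq_zero.1 h)
    rw [norm_one, norm_mul, norm_exp_ofReal_mul_I, mul_one] at this
    linarith
  rw [← one_sub_mul_exp_mul]
  refine mul_ne_zero (h t) ?_
  have := h (-t)
  rwa [ofReal_neg, neg_mul] at this

open Complex in
/-- The generating function of the Chebyshev polynomials of the second kind. -/
theorem hasSum_pow_mul_sin {w : ℂ} (hw : ‖w‖ < 1) (t : ℝ) :
    HasSum (fun n : ℕ => w ^ n * (Real.sin ((n + 1) * t) : ℂ))
      (Real.sin t / (1 - 2 * w * Real.cos t + w ^ 2)) := by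
  have hn : ∀ s : ℂ, ‖exp s‖ = 1 → ‖w * exp s‖ < 1 := fun s hs => by rwa [norm_mul, hs, mul_one]
  have hp : ‖exp (t * I)‖ = 1 := norm_exp_ofReal_mul_I t
  have hm : ‖exp (-(t * I))‖ = 1 := by
    have := norm_exp_ofReal_mul_I (-t)
    rwa [ofReal_neg, neg_mul] at this
  have h1 := (hasSum_geometric_of_norm_lt_one (hn _ hp)).mul_left (exp (t * I))
  have h2 := (hasSum_geometric_of_norm_lt_one (hn _ hm)).mul_left (exp (-(t * I)))
  have h3 := (h2.sub h1).mul_right (I / 2)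
  have hd := one_sub_mul_exp_mul w t
  have hd0 := one_sub_two_mul_cos_add_sq_ne_zero hw t
  have hd1 := hd0
  rw [← hd] at hd1
  have ha := left_ne_zero_of_mul hd1
  have hb := right_ne_zero_of_mul hd1
  have hl : (fun n : ℕ => w ^ n * (Real.sin ((n + 1) * t) : ℂ)) = fun n : ℕ =>
      (exp (-(t * I)) * (w * exp (-(t * I))) ^ n - exp (t * I) * (w * exp (t * I)) ^ n) *
        (I / 2) := by
    ext n
    rw [ofReal_sin, Complex.sin, mul_pow, mul_pow, ← exp_nat_mul, ← exp_nat_mul]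
    have e1 : exp (t * I) * exp (n * (t * I)) = exp (((n + 1) * t : ℝ) * I) := by
      rw [← exp_add]; congr 1; push_cast; ring
    have e2 : exp (-(t * I)) * exp (n * -(t * I)) = exp (-((n + 1) * t : ℝ) * I) := by
      rw [← exp_add]; congr 1; push_cast; ring
    rw [← e1, ← e2]
    ring
  have hr : (Real.sin t : ℂ) / (1 - 2 * w * Real.cos t + w ^ 2) =
      (exp (-(t * I)) * (1 - w * exp (-(t * I)))⁻¹ - exp (t * I) * (1 - w * exp (t * I))⁻¹) *
        (I / 2) := by
    rw [← hd, ofReal_sin, Complex.sin, neg_mul]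
    generalize exp (t * I) = x at ha ⊢
    generalize exp (-(t * I)) = y at hb ⊢
    rw [← div_eq_mul_inv, ← div_eq_mul_inv, div_sub_div _ _ hb ha, div_mul_eq_mul_div,
      div_eq_div_iff (mul_ne_zero ha hb) (mul_ne_zero hb ha)]
    ring
  rw [hl, hr]
  exact h3

open Real in
theorem integral_sin_sq_div {w : ℂ} (hw : ‖w‖ < 1) :
    ∫ t in (0 : ℝ)..π, (sin t : ℂ) ^ 2 / (1 - 2 * w * cos t + w ^ 2) = (π : ℂ) / 2 := by
  have h := intervalIntegral.hasSum_integral_of_dominated_convergence (a := 0) (b := π)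
    (μ := volume) (F := fun (n : ℕ) (t : ℝ) => w ^ n * ((sin t * sin ((n + 1) * t) : ℝ) : ℂ))
    (f := fun t => (sin t : ℂ) ^ 2 / (1 - 2 * w * cos t + w ^ 2))
    (fun n _ => ‖w‖ ^ n) (fun n => by
      apply Continuous.aestronglyMeasurable
      fun_prop)
    (fun n => Filter.Eventually.of_forall fun t _ => by
      rw [norm_mul, norm_pow, Complex.norm_real, norm_eq_abs, abs_mul]
      have := mul_le_one₀ (abs_sin_le_one t) (abs_nonneg _) (abs_sin_le_one ((n + 1) * t))
      exact mul_le_of_le_one_right (by positivity) this)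
    (Filter.Eventually.of_forall fun t _ => summable_geometric_of_lt_one (norm_nonneg _) hw)
    (by simp)
    (Filter.Eventually.of_forall fun t _ => by
      have := (hasSum_pow_mul_sin hw t).mul_left (sin t : ℂ)
      have hl : (fun n : ℕ => w ^ n * ((sin t * sin ((n + 1) * t) : ℝ) : ℂ)) = fun n : ℕ =>
          (sin t : ℂ) * (w ^ n * (sin ((n + 1) * t) : ℂ)) := by
        ext n
        rw [Complex.ofReal_mul]
        ring
      rw [hl, sq, mul_div_assoc]
      exact this)
  have h' : ∀ n : ℕ, ∫ t in (0 : ℝ)..π, w ^ n * ((sin t * sin ((n + 1) * t) : ℝ) : ℂ) =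
      if n = 0 then (π / 2 : ℂ) else 0 := fun n => by
    rw [intervalIntegral.integral_const_mul, intervalIntegral.integral_ofReal,
      integral_sin_mul_sin_succ_mul]
    split_ifs with hn <;> simp [hn]
  simp_rw [h'] at h
  exact h.unique (hasSum_ite_eq 0 _)

open Real in
theorem sin_sq_add_mul_cos_sq_pos {t : ℝ} (ht : t ∈ Set.Ioo 0 π) (d : ℝ) :
    0 < sin t ^ 2 + d ^ 2 * cos t ^ 2 := by
  have := sin_pos_of_pos_of_lt_pi ht.1 ht.2
  positivity

open Real in
theorem integral_sin_sq_div_add_of_pos {d : ℝ} (hd : 0 < d) :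
    ∫ t in (0 : ℝ)..π, sin t ^ 2 / (sin t ^ 2 + d ^ 2 * cos t ^ 2) = π / (1 + d) := by
  -- the two denominators `1 ∓ 2 w cos t + w ^ 2` multiply to a multiple of the given one
  obtain ⟨w, hw⟩ := IsAlgClosed.exists_pow_nat_eq (((1 - d) / (1 + d) : ℝ) : ℂ) (n := 2)
    (by norm_num)
  have hd1 : (1 + d : ℂ) ≠ 0 := by exact_mod_cast (by positivity : (1 + d : ℝ) ≠ 0)
  have hwn : ‖w‖ < 1 := by
    have h := congrArg norm hw
    rw [norm_pow, Complex.norm_real, norm_eq_abs] at h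
    have : |(1 - d) / (1 + d)| < 1 := by
      rw [abs_div, abs_of_pos (by positivity : 0 < 1 + d), div_lt_one (by positivity), abs_lt]
      constructor <;> linarith
    rw [← h] at this
    exact (pow_lt_one_iff_of_nonneg (norm_nonneg _) two_ne_zero).1 this
  have hwn' : ‖-w‖ < 1 := by rwa [norm_neg]
  have hint : ∀ {w : ℂ}, ‖w‖ < 1 → IntervalIntegrable
      (fun t : ℝ => (sin t : ℂ) ^ 2 / (1 - 2 * w * cos t + w ^ 2)) volume 0 π := fun hw => by
    apply Continuous.intervalIntegrable
    exact Continuous.div (by fun_prop) (by fun_prop) (one_sub_two_mul_cos_add_sq_ne_zero hw)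
  have h := intervalIntegral.integral_add (hint hwn) (hint hwn')
  rw [integral_sin_sq_div hwn, integral_sin_sq_div hwn'] at h
  have hpt : ∀ t : ℝ, (sin t : ℂ) ^ 2 / (1 - 2 * w * cos t + w ^ 2) +
      (sin t : ℂ) ^ 2 / (1 - 2 * (-w) * cos t + (-w) ^ 2) =
      (1 + d) * ((sin t ^ 2 / (sin t ^ 2 + d ^ 2 * cos t ^ 2) : ℝ) : ℂ) := by
    intro t
    have h1 := one_sub_two_mul_cos_add_sq_ne_zero hwn t
    have h2 := one_sub_two_mul_cos_add_sq_ne_zero hwn' t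
    have hsc : (sin t : ℂ) ^ 2 = 1 - (cos t : ℂ) ^ 2 := by
      exact_mod_cast sin_sq t
    have hw' : (1 + d) * w ^ 2 = (1 - d : ℂ) := by
      rw [hw]; push_cast; field_simp
    have hpr : (1 + d) ^ 2 * ((1 - 2 * w * cos t + w ^ 2) * (1 - 2 * (-w) * cos t + (-w) ^ 2)) =
        4 * ((sin t : ℂ) ^ 2 + d ^ 2 * (cos t : ℂ) ^ 2) := by
      rw [hsc]
      linear_combination ((1 + d) * w ^ 2 + (1 - d) + 2 * (1 + d) -
        4 * (1 + d) * (cos t : ℂ) ^ 2) * hw'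
    have h3 : (sin t : ℂ) ^ 2 + d ^ 2 * (cos t : ℂ) ^ 2 ≠ 0 := by
      intro h0
      rw [h0, mul_zero] at hpr
      exact mul_ne_zero (pow_ne_zero 2 hd1) (mul_ne_zero h1 h2) hpr
    simp only [Complex.ofReal_div, Complex.ofReal_add, Complex.ofReal_mul, Complex.ofReal_pow]
    rw [div_add_div _ _ h1 h2, mul_div_assoc', div_eq_div_iff (mul_ne_zero h1 h2) h3]
    linear_combination (sin t : ℂ) ^ 2 * (-(1 / 2 : ℂ) * (1 + w ^ 2) * hpr + (1 + d) / 2 *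
      ((1 - 2 * w * cos t + w ^ 2) * (1 - 2 * (-w) * cos t + (-w) ^ 2)) * hw')
  simp_rw [hpt] at h
  rw [intervalIntegral.integral_const_mul, intervalIntegral.integral_ofReal] at h
  have h : (1 + d) * ∫ t in (0 : ℝ)..π, sin t ^ 2 / (sin t ^ 2 + d ^ 2 * cos t ^ 2) =
      π / 2 + π / 2 := by
    exact_mod_cast h
  rw [eq_div_iff (by positivity)]
  linarith

open Real in
theorem integral_sin_sq_div_add (d : ℝ) :
    ∫ t in (0 : ℝ)..π, sin t ^ 2 / (sin t ^ 2 + d ^ 2 * cos t ^ 2) = π / (1 + |d|) := by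
  rcases eq_or_ne d 0 with rfl | hd
  · rw [intervalIntegral.integral_congr_Ioo_of_le (g := fun _ => (1 : ℝ)) pi_pos.le]
    · simp
    · intro t ht
      have := sin_pos_of_pos_of_lt_pi ht.1 ht.2
      simp [this.ne']
  · rw [← sq_abs d]
    exact integral_sin_sq_div_add_of_pos (abs_pos.2 hd)

open Real in
theorem integral_cos_pow_two_mul (k : ℕ) :
    ∫ t in (0 : ℝ)..π, cos t ^ (2 * k) = π * k.centralBinom / 4 ^ k := by
  induction k with
  | zero => simp
  | succ k ih =>
    have h : ((k : ℝ) + 1) * (k + 1).centralBinom = 2 * (2 * k + 1) * k.centralBinom := by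
      exact_mod_cast Nat.succ_mul_centralBinom_succ k
    rw [mul_add, mul_one, integral_cos_pow, ih]
    simp only [sin_pi, sin_zero, mul_zero, sub_zero, zero_div, zero_add]
    have h' : ((k + 1).centralBinom : ℝ) = 2 * (2 * k + 1) * k.centralBinom / (k + 1) := by
      rw [eq_div_iff (by positivity), ← h]; ring
    rw [h', pow_succ]
    push_cast
    field_simp
    ring

open Real in
/-- The moments of the semicircle law, up to normalization. -/
theorem integral_sin_sq_mul_cos_pow (k : ℕ) :
    ∫ t in (0 : ℝ)..π, sin t ^ 2 * cos t ^ (2 * k) = π / 2 * (catalan k / 4 ^ k) := by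
  have h1 : ∀ t : ℝ, sin t ^ 2 * cos t ^ (2 * k) = cos t ^ (2 * k) - cos t ^ (2 * (k + 1)) := by
    intro t; rw [sin_sq]; ring
  have h : ((k : ℝ) + 1) * (k + 1).centralBinom = 2 * (2 * k + 1) * k.centralBinom := by
    exact_mod_cast Nat.succ_mul_centralBinom_succ k
  have h2 : ((k : ℝ) + 1) * catalan k = k.centralBinom := by
    exact_mod_cast succ_mul_catalan_eq_centralBinom k
  simp_rw [h1]
  rw [intervalIntegral.integral_sub (by apply Continuous.intervalIntegrable; fun_prop)
    (by apply Continuous.intervalIntegrable; fun_prop), integral_cos_pow_two_mul,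
    integral_cos_pow_two_mul]
  have h3 : ((k + 1).centralBinom : ℝ) = 2 * (2 * k + 1) * catalan k := by
    have : (k : ℝ) + 1 ≠ 0 := by positivity
    apply mul_left_cancel₀ this
    rw [h, ← h2]; ring
  rw [h3, ← h2]
  field_simp
  ring

/-! ### The branch of the square root and the semicircle law -/

section SqrtBranch

variable {a : ℝ} {z : ℂ}

theorem sqrtBranch_sq (a : ℝ) (z : ℂ) : sqrtBranch a z ^ 2 = z ^ 2 - (a : ℂ) ^ 2 := by
  have h : ∀ x : ℂ, (x ^ (1 / 2 : ℂ)) ^ 2 = x := fun x => by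
    rw [one_div]
    exact Complex.cpow_nat_inv_pow x two_ne_zero
  rw [sqrtBranch, mul_pow, h, h]
  ring

/-- Off the segment, `√(z - a)` and `√(z + a)` enclose an acute angle. -/
theorem re_cpow_half_mul_conj_pos (hz : ∀ x ∈ Set.Icc (-a) a, z ≠ (x : ℂ)) (ha : 0 ≤ a) :
    0 < ((z - a) ^ (1 / 2 : ℂ) * (starRingEnd ℂ) ((z + a) ^ (1 / 2 : ℂ))).re := by
  have hi1 : (z - a).im = z.im := by simp
  have hi2 : (z + a).im = z.im := by simp
  have hr1 : (z - a).re = z.re - a := by simp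
  have hr2 : (z + a).re = z.re + a := by simp
  have him : ((z - a) ^ (2⁻¹ : ℂ)).im * ((z + a) ^ (2⁻¹ : ℂ)).im =
      √((‖z - a‖ - (z - a).re) / 2) * √((‖z + a‖ - (z + a).re) / 2) := by
    rcases le_or_gt 0 z.im with h | h
    · rw [Complex.cpow_inv_two_im_eq_sqrt (by rwa [hi1]),
        Complex.cpow_inv_two_im_eq_sqrt (by rwa [hi2])]
    · rw [Complex.cpow_inv_two_im_eq_neg_sqrt (by rwa [hi1]),
        Complex.cpow_inv_two_im_eq_neg_sqrt (by rwa [hi2])]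
      ring
  rw [one_div, Complex.mul_re, Complex.conj_re, Complex.conj_im, mul_neg, sub_neg_eq_add, him,
    Complex.cpow_inv_two_re, Complex.cpow_inv_two_re]
  by_cases h0 : z.im = 0
  · have hzr : z = (z.re : ℂ) := Complex.ext (by simp) (by simp [h0])
    have hout : z.re < -a ∨ a < z.re := by
      by_contra! h
      exact hz z.re ⟨h.1, h.2⟩ hzr
    have hn1 : ‖z - a‖ = |z.re - a| := by
      rw [hzr, ← Complex.ofReal_sub, Complex.norm_real]; simp
    have hn2 : ‖z + a‖ = |z.re + a| := by
      rw [hzr, ← Complex.ofReal_add, Complex.norm_real]; simp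
    rw [hn1, hn2, hr1, hr2]
    rcases hout with h | h
    · refine add_pos_of_nonneg_of_pos (by positivity) ?_
      rw [abs_of_neg (by linarith), abs_of_neg (by linarith)]
      exact mul_pos (Real.sqrt_pos.2 (by linarith)) (Real.sqrt_pos.2 (by linarith))
    · refine add_pos_of_pos_of_nonneg ?_ (by positivity)
      rw [abs_of_pos (by linarith), abs_of_pos (by linarith)]
      exact mul_pos (Real.sqrt_pos.2 (by linarith)) (Real.sqrt_pos.2 (by linarith))
  · refine add_pos_of_pos_of_nonneg ?_ (by positivity)
    have h1 := Complex.abs_re_lt_norm.2 (show (z - a).im ≠ 0 by rwa [hi1])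
    have h2 := Complex.abs_re_lt_norm.2 (show (z + a).im ≠ 0 by rwa [hi2])
    rw [abs_lt] at h1 h2
    exact mul_pos (Real.sqrt_pos.2 (by linarith)) (Real.sqrt_pos.2 (by linarith))

theorem norm_sub_sqrtBranch_lt (hz : ∀ x ∈ Set.Icc (-a) a, z ≠ (x : ℂ)) (ha : 0 ≤ a) :
    ‖z - sqrtBranch a z‖ < ‖z + sqrtBranch a z‖ := by
  have h := re_cpow_half_mul_conj_pos hz ha
  have hs : ∀ x : ℂ, (x ^ (1 / 2 : ℂ)) ^ 2 = x := fun x => by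
    rw [one_div]
    exact Complex.cpow_nat_inv_pow x two_ne_zero
  have h1 := hs (z - a)
  have h2 := hs (z + a)
  rw [sqrtBranch]
  set α := (z - a) ^ (1 / 2 : ℂ)
  set β := (z + a) ^ (1 / 2 : ℂ)
  have hz2 : z = (α ^ 2 + β ^ 2) / 2 := by rw [h1, h2]; ring
  -- `z - α β = (α - β)² / 2` and `z + α β = (α + β)² / 2`
  have e1 : z - α * β = (α - β) ^ 2 / 2 := by rw [hz2]; ring
  have e2 : z + α * β = (α + β) ^ 2 / 2 := by rw [hz2]; ring
  rw [e1, e2, norm_div, norm_div, norm_pow, norm_pow, Complex.sq_norm, Complex.sq_norm,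
    Complex.normSq_sub, Complex.normSq_add]
  have : (0 : ℝ) < ‖(2 : ℂ)‖ := by simp
  gcongr
  linarith

open Real in
/-- The Cauchy transform of the semicircle law. -/
theorem integral_sin_sq_div_sub (ha : 0 < a) (hz : ∀ x ∈ Set.Icc (-a) a, z ≠ (x : ℂ)) :
    ∫ t in (0 : ℝ)..π, (sin t : ℂ) ^ 2 / (z - (a * cos t : ℝ)) =
      (π : ℂ) * (z - sqrtBranch a z) / a ^ 2 := by
  have hac : (a : ℂ) ≠ 0 := by exact_mod_cast ha.ne'
  have hsq := sqrtBranch_sq a z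
  have hlt := norm_sub_sqrtBranch_lt hz ha.le
  set u := sqrtBranch a z
  have hprod : (z - u) * (z + u) = a ^ 2 := by linear_combination -hsq
  have hne : z - u ≠ 0 := fun h => by
    rw [h, zero_mul] at hprod
    exact pow_ne_zero 2 hac hprod.symm
  set w := (z - u) / a with hw
  have hw0 : w ≠ 0 := div_ne_zero hne hac
  have hz' : 2 * w * z = a * (1 + w ^ 2) := by
    rw [hw]; field_simp; linear_combination hprod
  have hw1 : ‖w‖ < 1 := by
    have h := congrArg norm hprod
    rw [norm_mul, norm_pow, Complex.norm_real, norm_eq_abs, abs_of_pos ha] at h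
    rw [hw, norm_div, Complex.norm_real, norm_eq_abs, abs_of_pos ha, div_lt_one ha]
    nlinarith [norm_nonneg (z - u)]
  have hpt : ∀ t : ℝ, (sin t : ℂ) ^ 2 / (z - (a * cos t : ℝ)) =
      (2 * w / a) * ((sin t : ℂ) ^ 2 / (1 - 2 * w * cos t + w ^ 2)) := fun t => by
    have h1 := one_sub_two_mul_cos_add_sq_ne_zero hw1 t
    have h2 : z - (a * cos t : ℝ) = a / (2 * w) * (1 - 2 * w * cos t + w ^ 2) := by
      rw [Complex.ofReal_mul]
      field_simp
      linear_combination hz'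
    rw [h2]
    field_simp
  simp_rw [hpt]
  rw [intervalIntegral.integral_const_mul, integral_sin_sq_div hw1, hw]
  field_simp

end SqrtBranch

/-! ### Integration against the Kesten law -/

section Law

open Real

variable {p q : ℝ}

/-- The density of the absolutely continuous part of the Kesten law in the variable `t ∈ (0, π)`,
where `x = √(2(p+q)) cos t`. -/
noncomputable def kestenAngular (p q t : ℝ) : ℝ :=
  (p + q) / π * (sin t ^ 2 / (sin t ^ 2 + (1 - (p + q)) ^ 2 * cos t ^ 2))

theorem sqrt_two_mul_pos (hpq : 0 < p + q) : 0 < √(2 * (p + q)) := Real.sqrt_pos.2 (by linarith)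

theorem sqrt_two_mul_sq (hpq : 0 < p + q) : √(2 * (p + q)) ^ 2 = 2 * (p + q) :=
  Real.sq_sqrt (by linarith)

theorem image_mul_cos_Ioo {a : ℝ} (ha : 0 < a) :
    (fun t => a * cos t) '' Set.Ioo 0 π = Set.Ioo (-a) a := by
  ext x
  constructor
  · rintro ⟨t, ht, rfl⟩
    have h1 := cos_lt_cos_of_nonneg_of_le_pi le_rfl ht.2.le ht.1
    have h2 := cos_lt_cos_of_nonneg_of_le_pi ht.1.le le_rfl ht.2
    rw [cos_zero] at h1
    rw [cos_pi] at h2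
    exact ⟨by nlinarith, by nlinarith⟩
  · rintro ⟨h1, h2⟩
    have h3 : -1 < x / a := by rw [lt_div_iff₀ ha]; linarith
    have h4 : x / a < 1 := by rw [div_lt_one ha]; linarith
    refine ⟨arccos (x / a), ⟨arccos_pos.2 h4, arccos_lt_pi.2 h3⟩, ?_⟩
    simp only
    rw [cos_arccos h3.le h4.le]
    field_simp

/-- The factor `|-(a sin t)|` is the Jacobian of `x = a cos t`. -/
theorem mul_kestenDensity_cos (hpq : 0 < p + q) {t : ℝ} (ht : t ∈ Set.Ioo 0 π) :
    |-(√(2 * (p + q)) * sin t)| *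
      (ENNReal.ofReal (kestenDensity p q (√(2 * (p + q)) * cos t))).toReal =
      kestenAngular p q t := by
  have hs := sin_pos_of_pos_of_lt_pi ht.1 ht.2
  have ha := sqrt_two_mul_pos hpq
  have ha2 := sqrt_two_mul_sq hpq
  have hD := sin_sq_add_mul_cos_sq_pos ht (1 - (p + q))
  set a := √(2 * (p + q))
  have hden : 2 - (2 - p - q) * (a * cos t) ^ 2 =
      2 * (sin t ^ 2 + (1 - (p + q)) ^ 2 * cos t ^ 2) := by
    rw [mul_pow, ha2, sin_sq]; ring
  have hnum : √(2 * (p + q) - (a * cos t) ^ 2) = a * sin t := by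
    rw [← ha2, show a ^ 2 - (a * cos t) ^ 2 = (a * sin t) ^ 2 by
      rw [mul_pow a (sin t), sin_sq]; ring,
      Real.sqrt_sq (by positivity)]
  rw [kestenDensity, hden, hnum, ENNReal.toReal_ofReal (by positivity), abs_neg,
    abs_of_pos (by positivity), kestenAngular]
  field_simp
  linear_combination ha2

theorem continuousOn_kestenAngular : ContinuousOn (kestenAngular p q) (Set.Ioo 0 π) := by
  unfold kestenAngular
  refine continuousOn_const.mul (ContinuousOn.div (by fun_prop) (by fun_prop) fun t ht => ?_)
  exact (sin_sq_add_mul_cos_sq_pos ht _).ne'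

theorem abs_kestenAngular_le (hpq : 0 < p + q) (t : ℝ) : |kestenAngular p q t| ≤ (p + q) / π := by
  have h : sin t ^ 2 / (sin t ^ 2 + (1 - (p + q)) ^ 2 * cos t ^ 2) ≤ 1 :=
    div_le_one_of_le₀ (le_add_of_nonneg_right (by positivity)) (by positivity)
  rw [kestenAngular, abs_of_nonneg (by have := pi_pos; positivity)]
  exact mul_le_of_le_one_right (by have := pi_pos; positivity) h

theorem integral_kestenAngular (hpq : 0 < p + q) :
    ∫ t in (0 : ℝ)..π, kestenAngular p q t = (p + q) / (1 + |1 - (p + q)|) := by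
  simp only [kestenAngular]
  rw [intervalIntegral.integral_const_mul, integral_sin_sq_div_add]
  field_simp

variable {E : Type*} [NormedAddCommGroup E] [NormedSpace ℝ E]

theorem integrableOn_kestenAngular_smul (hpq : 0 < p + q) {g : ℝ → E}
    (hg : ContinuousOn g (Set.Icc (-√(2 * (p + q))) √(2 * (p + q)))) :
    IntegrableOn (fun t => kestenAngular p q t • g (√(2 * (p + q)) * cos t)) (Set.Ioo 0 π) := by
  have ha := sqrt_two_mul_pos hpq
  have hmaps : ∀ t : ℝ, √(2 * (p + q)) * cos t ∈ Set.Icc (-√(2 * (p + q))) √(2 * (p + q)) :=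
    fun t => ⟨by nlinarith [neg_one_le_cos t], by nlinarith [cos_le_one t]⟩
  obtain ⟨C, hC⟩ := isCompact_Icc.exists_bound_of_continuousOn hg
  refine Integrable.mono' (integrable_const ((p + q) / π * C)) ?_ ?_
  · exact (continuousOn_kestenAngular.smul (hg.comp (by fun_prop) fun t _ => hmaps t)
      ).aestronglyMeasurable measurableSet_Ioo
  · refine Filter.Eventually.of_forall fun t => ?_
    rw [norm_smul]
    exact mul_le_mul (abs_kestenAngular_le hpq t) (hC _ (hmaps t)) (norm_nonneg _)
      (by have := pi_pos; positivity)

theorem measurable_kestenDensity : Measurable (kestenDensity p q) := by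
  unfold kestenDensity
  fun_prop

variable [CompleteSpace E]

/-- Integration against the Kesten law in the angular variable. -/
theorem integrable_kestenLaw (hpq : 0 < p + q) {g : ℝ → E}
    (hg : ContinuousOn g (Set.Icc (-√(2 * (p + q))) √(2 * (p + q)))) :
    Integrable g (kestenLaw p q) ∧
    ∫ x, g x ∂(kestenLaw p q) =
      (∫ t in (0 : ℝ)..π, kestenAngular p q t • g (√(2 * (p + q)) * cos t)) +
        kestenMass p q • (g (kestenAtom p q) + g (-kestenAtom p q)) := by
  have ha := sqrt_two_mul_pos hpq
  have hmeas : Measurable fun x => ENNReal.ofReal (kestenDensity p q x) :=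
    measurable_kestenDensity.ennreal_ofReal
  have hlt : ∀ μ : Measure ℝ, ∀ᵐ x ∂μ, ENNReal.ofReal (kestenDensity p q x) < ⊤ := fun μ =>
    Filter.Eventually.of_forall fun x => ENNReal.ofReal_lt_top
  have hder : ∀ t ∈ Set.Ioo 0 π, HasDerivWithinAt (fun t => √(2 * (p + q)) * cos t)
      (-(√(2 * (p + q)) * sin t)) (Set.Ioo 0 π) t := fun t _ => by
    rw [← mul_neg]
    exact ((hasDerivAt_cos t).const_mul _).hasDerivWithinAt
  have hinj : Set.InjOn (fun t => √(2 * (p + q)) * cos t) (Set.Ioo 0 π) := fun s hs t ht h =>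
    injOn_cos (Set.Ioo_subset_Icc_self hs) (Set.Ioo_subset_Icc_self ht)
      (mul_left_cancel₀ ha.ne' h)
  have hcongr : Set.EqOn (fun t => |-(√(2 * (p + q)) * sin t)| •
      ((ENNReal.ofReal (kestenDensity p q (√(2 * (p + q)) * cos t))).toReal •
        g (√(2 * (p + q)) * cos t)))
      (fun t => kestenAngular p q t • g (√(2 * (p + q)) * cos t)) (Set.Ioo 0 π) := fun t ht => by
    simp only
    rw [smul_smul, mul_kestenDensity_cos hpq ht]
  have hac : Integrable g ((volume.restrict (Set.Icc (-√(2 * (p + q))) √(2 * (p + q)))).withDensity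
      (fun x => ENNReal.ofReal (kestenDensity p q x))) := by
    rw [integrable_withDensity_iff_integrable_smul' hmeas (hlt _), ← IntegrableOn,
      integrableOn_Icc_iff_integrableOn_Ioo, ← image_mul_cos_Ioo ha,
      integrableOn_image_iff_integrableOn_abs_deriv_smul measurableSet_Ioo hder hinj,
      integrableOn_congr_fun hcongr measurableSet_Ioo]
    exact integrableOn_kestenAngular_smul hpq hg
  have hat : Integrable g (ENNReal.ofReal (kestenMass p q) •
      (Measure.dirac (kestenAtom p q) + Measure.dirac (-kestenAtom p q))) :=
    ((integrable_dirac (by simp)).add_measure (integrable_dirac (by simp))).smul_measure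
      ENNReal.ofReal_ne_top
  have hmass : 0 ≤ kestenMass p q := by
    rw [kestenMass]
    split_ifs with h
    · exact div_nonneg (by linarith) (by linarith)
    · exact le_rfl
  refine ⟨hac.add_measure hat, ?_⟩
  rw [kestenLaw, integral_add_measure hac hat, integral_smul_measure,
    integral_add_measure (integrable_dirac (by simp)) (integrable_dirac (by simp)),
    integral_dirac, integral_dirac, ENNReal.toReal_ofReal hmass,
    integral_withDensity_eq_integral_toReal_smul hmeas (hlt _), integral_Icc_eq_integral_Ioo,
    ← image_mul_cos_Ioo ha,
    integral_image_eq_integral_abs_deriv_smul measurableSet_Ioo hder hinj,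
    setIntegral_congr_fun measurableSet_Ioo hcongr, intervalIntegral.integral_of_le pi_pos.le,
    integral_Ioc_eq_integral_Ioo]

theorem kestenAtom_sq (h : kestenMass p q ≠ 0) :
    1 - (1 - (p + q) / 2) * kestenAtom p q ^ 2 = 0 := by
  have h1 : p + q < 1 := by
    by_contra h1
    exact h (if_neg h1)
  have h2 : 0 < 1 - (p + q) / 2 := by linarith
  rw [kestenAtom, div_pow, Real.sq_sqrt h2.le, one_pow, mul_one_div_cancel h2.ne',
    sub_self]

/-- Up to the factor `1 - (1 - (p+q)/2) x ^ 2`, which vanishes at the atoms, the Kesten law is a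
semicircle law. -/
theorem integral_kestenLaw_mul_quadratic (hpq : 0 < p + q) {g : ℝ → E}
    (hg : ContinuousOn g (Set.Icc (-√(2 * (p + q))) √(2 * (p + q)))) :
    ∫ x, (1 - (1 - (p + q) / 2) * x ^ 2) • g x ∂(kestenLaw p q) =
      ((p + q) / π) • ∫ t in (0 : ℝ)..π, sin t ^ 2 • g (√(2 * (p + q)) * cos t) := by
  rw [(integrable_kestenLaw hpq (g := fun x => (1 - (1 - (p + q) / 2) * x ^ 2) • g x)
    (ContinuousOn.smul (by fun_prop) hg)).2]
  have h0 : kestenMass p q • ((1 - (1 - (p + q) / 2) * kestenAtom p q ^ 2) • g (kestenAtom p q) +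
      (1 - (1 - (p + q) / 2) * (-kestenAtom p q) ^ 2) • g (-kestenAtom p q)) = 0 := by
    rcases eq_or_ne (kestenMass p q) 0 with h | h
    · rw [h, zero_smul]
    · rw [neg_sq, kestenAtom_sq h]; simp
  rw [h0, add_zero, ← intervalIntegral.integral_smul]
  refine intervalIntegral.integral_congr_Ioo_of_le pi_pos.le fun t ht => ?_
  have hD := sin_sq_add_mul_cos_sq_pos ht (1 - (p + q))
  simp only [smul_smul]
  congr 1
  have h2 : 1 - (1 - (p + q) / 2) * (√(2 * (p + q)) * cos t) ^ 2 =
      sin t ^ 2 + (1 - (p + q)) ^ 2 * cos t ^ 2 := by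
    rw [mul_pow, sqrt_two_mul_sq hpq, sin_sq]; ring
  rw [h2, kestenAngular]
  field_simp

/-- The absolutely continuous part has mass `(p+q) / (1 + |1 - (p+q)|)`, which is `1` when
`1 ≤ p + q`; otherwise the atoms supply what is missing. -/
theorem isProbabilityMeasure_kestenLaw (hpq : 0 < p + q) :
    IsProbabilityMeasure (kestenLaw p q) := by
  have h := (integrable_kestenLaw hpq (g := fun _ => (1 : ℝ)) continuousOn_const).2
  simp only [smul_eq_mul, mul_one] at h
  rw [integral_kestenAngular hpq, integral_const, smul_eq_mul, mul_one] at h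
  have h1 : (kestenLaw p q).real Set.univ = 1 := by
    rw [h, kestenMass]
    split_ifs with h1
    · rw [abs_of_pos (by linarith), show 1 + (1 - (p + q)) = 2 - (p + q) by ring]
      have : 2 - (p + q) ≠ 0 := by linarith
      field_simp
      ring
    · rw [abs_of_nonpos (by linarith), show 1 + -(1 - (p + q)) = p + q by ring,
        div_self hpq.ne', zero_mul, add_zero]
  exact ⟨by rwa [Measure.real, ENNReal.toReal_eq_one_iff] at h1⟩

theorem integrable_pow_kestenLaw (hpq : 0 < p + q) (n : ℕ) :
    Integrable (fun x : ℝ => x ^ n) (kestenLaw p q) :=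
  (integrable_kestenLaw hpq (by fun_prop)).1

theorem integral_pow_kestenLaw_of_odd (hpq : 0 < p + q) {n : ℕ} (hn : Odd n) :
    ∫ x, x ^ n ∂(kestenLaw p q) = 0 := by
  rw [(integrable_kestenLaw hpq (by fun_prop)).2, hn.neg_pow, add_neg_cancel, smul_zero, add_zero]
  have h := intervalIntegral.integral_comp_sub_left (a := 0) (b := π)
    (fun t => kestenAngular p q t • (√(2 * (p + q)) * cos t) ^ n) π
  simp only [sub_self, sub_zero] at h
  have h' : ∀ t, kestenAngular p q (π - t) • (√(2 * (p + q)) * cos (π - t)) ^ n =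
      -(kestenAngular p q t • (√(2 * (p + q)) * cos t) ^ n) := fun t => by
    rw [kestenAngular, kestenAngular, sin_pi_sub, cos_pi_sub, mul_neg, hn.neg_pow, neg_sq, smul_neg]
  simp_rw [h'] at h
  rw [intervalIntegral.integral_neg] at h
  linarith

theorem integral_pow_kestenLaw_sub (hpq : 0 < p + q) (k : ℕ) :
    ∫ x, x ^ (2 * k) ∂(kestenLaw p q) -
      (1 - (p + q) / 2) * ∫ x, x ^ (2 * (k + 1)) ∂(kestenLaw p q) =
      ((p + q) / 2) ^ (k + 1) * catalan k := by
  rw [← integral_const_mul, ← integral_sub (integrable_pow_kestenLaw hpq _)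
    ((integrable_pow_kestenLaw hpq _).const_mul _)]
  have h := integral_kestenLaw_mul_quadratic hpq (g := fun x : ℝ => x ^ (2 * k)) (by fun_prop)
  have h1 : ∀ x : ℝ, x ^ (2 * k) - (1 - (p + q) / 2) * x ^ (2 * (k + 1)) =
      (1 - (1 - (p + q) / 2) * x ^ 2) • x ^ (2 * k) := fun x => by rw [smul_eq_mul]; ring
  have h2 : ∀ t : ℝ, sin t ^ 2 • (√(2 * (p + q)) * cos t) ^ (2 * k) =
      (2 * (p + q)) ^ k * (sin t ^ 2 * cos t ^ (2 * k)) := fun t => by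
    rw [smul_eq_mul, mul_pow, pow_mul (√(2 * (p + q))), sqrt_two_mul_sq hpq]; ring
  simp_rw [h1]
  rw [h]
  simp_rw [h2]
  rw [intervalIntegral.integral_const_mul, integral_sin_sq_mul_cos_pow, smul_eq_mul]
  have h4 : (2 * (p + q)) ^ k = ((p + q) / 2) ^ k * 4 ^ k := by rw [← mul_pow]; congr 1; ring
  rw [h4]
  field_simp
  ring

/-- The moments satisfy the recursion `kestenR_sub` of the sums over pairings. At `p + q = 2`,
where this recursion is no recursion but a formula, the Kesten law is the semicircle law. -/
theorem integral_pow_kestenLaw (hpq : 0 < p + q) (k : ℕ) :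
    ∫ x, x ^ (2 * k) ∂(kestenLaw p q) = kestenR p q k := by
  have := isProbabilityMeasure_kestenLaw hpq
  have hsub : ∀ k, ∫ x, x ^ (2 * k) ∂(kestenLaw p q) - kestenR p q k =
      (1 - (p + q) / 2) * (∫ x, x ^ (2 * (k + 1)) ∂(kestenLaw p q) - kestenR p q (k + 1)) := by
    intro k
    linarith [integral_pow_kestenLaw_sub hpq k, kestenR_sub p q k]
  rw [← sub_eq_zero]
  rcases eq_or_ne (1 - (p + q) / 2) 0 with h0 | h0
  · rw [hsub, h0, zero_mul]
  · induction k with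
    | zero => simp [kestenR_zero]
    | succ k ih =>
      rw [hsub] at ih
      exact (mul_eq_zero.1 ih).resolve_left h0

theorem hasMoments_kestenLaw (hpq : 0 < p + q) :
    HasMoments (kestenLaw p q) (kestenMoment p q) := by
  intro n
  refine ⟨integrable_pow_kestenLaw hpq n, ?_⟩
  rw [kestenMoment]
  split_ifs with hn
  · rw [← integral_pow_kestenLaw hpq, Nat.two_mul_div_two_of_even hn]
  · exact integral_pow_kestenLaw_of_odd hpq (Nat.not_even_iff_odd.1 hn)

/-- The Kesten law lives on its segment and on the zeros of the quadratic in the density. -/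
theorem ae_kestenLaw (p q : ℝ) :
    ∀ᵐ x ∂(kestenLaw p q), x ∈ Set.Icc (-√(2 * (p + q))) √(2 * (p + q)) ∨
      1 - (1 - (p + q) / 2) * x ^ 2 = 0 := by
  rw [kestenLaw, ae_add_measure_iff]
  constructor
  · refine (withDensity_absolutelyContinuous _ _).ae_le ?_
    filter_upwards [ae_restrict_mem measurableSet_Icc] with x hx using Or.inl hx
  · rcases eq_or_ne (kestenMass p q) 0 with h | h
    · simp [h]
    · refine Measure.ae_smul_measure ?_ _
      rw [ae_add_measure_iff, ae_dirac_eq, ae_dirac_eq]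
      simp only [Filter.eventually_pure, neg_sq]
      exact ⟨Or.inr (kestenAtom_sq h), Or.inr (kestenAtom_sq h)⟩

theorem exists_abs_le_ae_kestenLaw (p q : ℝ) : ∃ R : ℝ, ∀ᵐ x ∂(kestenLaw p q), |x| ≤ R := by
  refine ⟨√(2 * (p + q)) + |(1 - (p + q) / 2)⁻¹| + 1, ?_⟩
  filter_upwards [ae_kestenLaw p q] with x hx
  have h1 := Real.sqrt_nonneg (2 * (p + q))
  have h2 := abs_nonneg (1 - (p + q) / 2)⁻¹
  rcases hx with hx | hx
  · have := abs_le.2 hx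
    linarith
  · have h3 : (1 - (p + q) / 2) ≠ 0 := fun h => by rw [h] at hx; norm_num at hx
    have h4 : (1 - (p + q) / 2)⁻¹ = x ^ 2 := by
      rw [inv_eq_iff_eq_inv, ← one_div, eq_div_iff fun h => by rw [h] at hx; norm_num at hx]
      linarith
    rw [h4, abs_of_nonneg (sq_nonneg x), ← sq_abs]
    nlinarith [sq_nonneg (|x| - 1)]

/-- The Cauchy transform of the Kesten law, computed from that of the semicircle law. -/
theorem integral_kestenLaw_cauchy (hpq : 0 < p + q) {z : ℂ}
    (hz : ∀ x ∈ Set.Icc (-√(2 * (p + q))) √(2 * (p + q)), z ≠ (x : ℂ))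
    (hd : 2 - (2 - (p : ℂ) - (q : ℂ)) * z ^ 2 ≠ 0) :
    Integrable (fun x : ℝ => 1 / (z - (x : ℂ))) (kestenLaw p q) ∧
      ∫ x : ℝ, 1 / (z - (x : ℂ)) ∂(kestenLaw p q) =
        (((p : ℂ) + (q : ℂ) - 1) * z - sqrtBranch (√(2 * (p + q))) z) /
          (2 - (2 - (p : ℂ) - (q : ℂ)) * z ^ 2) := by
  have := isProbabilityMeasure_kestenLaw hpq
  have hg : ContinuousOn (fun x : ℝ => 1 / (z - (x : ℂ)))
      (Set.Icc (-√(2 * (p + q))) √(2 * (p + q))) :=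
    ContinuousOn.div continuousOn_const (by fun_prop) fun x hx => sub_ne_zero.2 (hz x hx)
  have hint := (integrable_kestenLaw hpq hg).1
  refine ⟨hint, ?_⟩
  have hcore := integral_kestenLaw_mul_quadratic hpq hg
  have hsemi : ∫ t in (0 : ℝ)..π, sin t ^ 2 • (1 / (z - ((√(2 * (p + q)) * cos t : ℝ) : ℂ))) =
      (π : ℂ) * (z - sqrtBranch (√(2 * (p + q))) z) / (√(2 * (p + q)) : ℂ) ^ 2 := by
    rw [← integral_sin_sq_div_sub (sqrt_two_mul_pos hpq) hz]
    congr 1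
    ext t
    rw [Complex.real_smul, Complex.ofReal_pow]
    ring
  have ha2 : (√(2 * (p + q)) : ℂ) ^ 2 = 2 * (p + q) := by
    exact_mod_cast congrArg (fun x : ℝ => (x : ℂ)) (sqrt_two_mul_sq hpq)
  have hpqc : (p + q : ℂ) ≠ 0 := by exact_mod_cast hpq.ne'
  rw [hsemi, ha2] at hcore
  -- divide the quadratic by `z - x`, with remainder its value at `z`
  have hae : (fun x : ℝ => (1 - (1 - (p + q) / 2) * x ^ 2) • (1 / (z - (x : ℂ)))) =ᵐ[kestenLaw p q]
      fun x : ℝ => (2 - (2 - (p : ℂ) - q) * z ^ 2) / 2 * (1 / (z - (x : ℂ))) +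
        (2 - (p : ℂ) - q) / 2 * (z + ((x ^ 1 : ℝ) : ℂ)) := by
    filter_upwards [ae_kestenLaw p q] with x hx
    have hzx : z - (x : ℂ) ≠ 0 := by
      rw [sub_ne_zero]
      rcases hx with hx | hx
      · exact hz x hx
      · rintro rfl
        apply hd
        have := congrArg (fun y : ℝ => (y : ℂ)) hx
        push_cast at this
        linear_combination 2 * this
    rw [Complex.real_smul]
    push_cast
    field_simp
    ring
  have hx1 : Integrable (fun x : ℝ => ((x ^ 1 : ℝ) : ℂ)) (kestenLaw p q) :=
    (integrable_pow_kestenLaw hpq 1).ofReal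
  have hx2 : Integrable (fun x : ℝ => z + ((x ^ 1 : ℝ) : ℂ)) (kestenLaw p q) :=
    (integrable_const z).add hx1
  rw [integral_congr_ae hae, integral_add (hint.const_mul _) (hx2.const_mul _),
    integral_const_mul, integral_const_mul,
    integral_add (integrable_const z) hx1, integral_complex_ofReal,
    integral_pow_kestenLaw_of_odd hpq odd_one] at hcore
  simp only [integral_const, probReal_univ, one_smul, Complex.ofReal_zero, add_zero,
    Complex.real_smul] at hcore
  rw [eq_div_iff hd]
  have hpi : (π : ℂ) ≠ 0 := by exact_mod_cast pi_ne_zero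
  have hsimp : ((((p + q) / π : ℝ)) : ℂ) * ((π : ℂ) * (z - sqrtBranch (√(2 * (p + q))) z) /
      (2 * (p + q))) = (z - sqrtBranch (√(2 * (p + q))) z) / 2 := by
    push_cast
    field_simp
  rw [hsimp] at hcore
  linear_combination 2 * hcore

end Law

/-! ### Determinacy of the moment problem -/

/-- Chebyshev's inequality with moments of high order. -/
theorem measure_le_abs_eq_zero {ν : Measure ℝ} {R S C : ℝ} (hR : 0 ≤ R) (hRS : R < S)
    (hi : ∀ n : ℕ, Integrable (fun x : ℝ => x ^ n) ν)
    (hm : ∀ k : ℕ, ∫ x, x ^ (2 * k) ∂ν ≤ C * R ^ (2 * k)) :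
    ν {x | S ≤ |x|} = 0 := by
  have hS : 0 < S := hR.trans_lt hRS
  have hfin : IsFiniteMeasure ν := by
    have := hi 0
    simp only [pow_zero] at this
    exact (integrable_const_iff_isFiniteMeasure one_ne_zero).1 this
  have hk : ∀ k : ℕ, ν.real {x | S ≤ |x|} ≤ C * ((R / S) ^ 2) ^ k := fun k => by
    have h := mul_meas_ge_le_integral_of_nonneg (μ := ν) (f := fun x : ℝ => x ^ (2 * k))
      (Filter.Eventually.of_forall fun x => (even_two_mul k).pow_nonneg x) (hi _) (S ^ (2 * k))
    have hsub : ν.real {x | S ≤ |x|} ≤ ν.real {x | S ^ (2 * k) ≤ x ^ (2 * k)} := by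
      refine measureReal_mono fun x hx => ?_
      have hx : S ≤ |x| := hx
      have := pow_le_pow_left₀ hS.le hx (2 * k)
      rwa [(even_two_mul k).pow_abs] at this
    have h1 := (mul_le_mul_of_nonneg_left hsub (pow_nonneg hS.le (2 * k))).trans (h.trans (hm k))
    rw [← pow_mul, div_pow, mul_div_assoc', le_div_iff₀ (by positivity)]
    linarith
  have hlim : Filter.Tendsto (fun k : ℕ => C * ((R / S) ^ 2) ^ k) Filter.atTop (nhds (C * 0)) := by
    refine (tendsto_pow_atTop_nhds_zero_of_lt_one (by positivity) ?_).const_mul C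
    rw [sq_lt_one_iff₀ (by positivity), div_lt_one hS]
    exact hRS
  have h0 := ge_of_tendsto' hlim hk
  rw [mul_zero] at h0
  exact (measureReal_eq_zero_iff).1 (le_antisymm h0 measureReal_nonneg)

theorem integral_polynomial_eq {μ ν : Measure ℝ} {m : ℕ → ℝ} (hμ : HasMoments μ m)
    (hν : HasMoments ν m) (P : Polynomial ℝ) :
    Integrable (fun x => P.eval x) μ ∧ Integrable (fun x => P.eval x) ν ∧
      ∫ x, P.eval x ∂μ = ∫ x, P.eval x ∂ν := by
  simp only [Polynomial.eval_eq_sum_range]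
  have h1 : ∀ i ∈ Finset.range (P.natDegree + 1), Integrable (fun x : ℝ => P.coeff i * x ^ i) μ :=
    fun i _ => (hμ i).1.const_mul _
  have h2 : ∀ i ∈ Finset.range (P.natDegree + 1), Integrable (fun x : ℝ => P.coeff i * x ^ i) ν :=
    fun i _ => (hν i).1.const_mul _
  refine ⟨integrable_finsetSum _ h1, integrable_finsetSum _ h2, ?_⟩
  rw [integral_finsetSum _ h1, integral_finsetSum _ h2]
  refine Finset.sum_congr rfl fun i _ => ?_
  rw [integral_const_mul, integral_const_mul, (hμ i).2, (hν i).2]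

/-- Two measures with the same moments, one of them with bounded support, agree: by Chebyshev's
inequality both have bounded support, and there polynomials are dense in the continuous
functions. -/
theorem eq_of_hasMoments {μ ν : Measure ℝ} {m : ℕ → ℝ} {R : ℝ}
    (hR : ∀ᵐ x ∂μ, |x| ≤ R) (hμ : HasMoments μ m) (hν : HasMoments ν m) : ν = μ := by
  have hfin : ∀ {ρ : Measure ℝ}, HasMoments ρ m → IsFiniteMeasure ρ := fun {ρ} h => by
    have := (h 0).1
    simp only [pow_zero] at this
    exact (integrable_const_iff_isFiniteMeasure one_ne_zero).1 this
  have := hfin hμ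
  have := hfin hν
  wlog hR0 : 0 ≤ R generalizing R
  · exact this (R := max R 0) (hR.mono fun x hx => hx.trans (le_max_left _ _)) (le_max_right _ _)
  have hbound : ∀ k : ℕ, m (2 * k) ≤ μ.real Set.univ * R ^ (2 * k) := fun k => by
    rw [← (hμ (2 * k)).2]
    have h := integral_mono_ae (hμ (2 * k)).1 (integrable_const (R ^ (2 * k))) (by
      filter_upwards [hR] with x hx
      have := pow_le_pow_left₀ (abs_nonneg x) hx (2 * k)
      rwa [(even_two_mul k).pow_abs] at this)
    rwa [integral_const, smul_eq_mul] at h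
  have hsupp : ∀ {ρ : Measure ℝ}, HasMoments ρ m → ∀ᵐ x ∂ρ, x ∈ Set.Icc (-(R + 1)) (R + 1) :=
      fun {ρ} h => by
    have h0 := measure_le_abs_eq_zero (ν := ρ) hR0 (lt_add_one R) (fun n => (h n).1)
      (fun k => by rw [(h (2 * k)).2]; exact hbound k)
    refine measure_mono_null (fun x hx => ?_) h0
    have hx : ¬ x ∈ Set.Icc (-(R + 1)) (R + 1) := hx
    rw [Set.mem_Icc, ← abs_le, not_le] at hx
    exact hx.le
  refine ext_of_forall_integral_eq_of_IsFiniteMeasure fun f => ?_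
  have hclose : ∀ ε > 0, |∫ x, f x ∂ν - ∫ x, f x ∂μ| ≤
      ε * (ν.real Set.univ + μ.real Set.univ) := fun ε hε => by
    obtain ⟨P, hP⟩ := exists_polynomial_near_of_continuousOn (-(R + 1)) (R + 1) f
      f.continuous.continuousOn ε hε
    obtain ⟨hPμ, hPν, hPe⟩ := integral_polynomial_eq hμ hν P
    have hone : ∀ {ρ : Measure ℝ} [IsFiniteMeasure ρ], HasMoments ρ m →
        Integrable (fun x => P.eval x) ρ →
        |∫ x, f x ∂ρ - ∫ x, P.eval x ∂ρ| ≤ ε * ρ.real Set.univ := fun {ρ} _ h hi => by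
      rw [← integral_sub (f.integrable ρ) hi, ← Real.norm_eq_abs]
      refine norm_integral_le_of_norm_le_const ?_
      filter_upwards [hsupp h] with x hx
      rw [Real.norm_eq_abs, abs_sub_comm]
      exact (hP x hx).le
    have h1 := abs_le.1 (hone hν hPν)
    have h2 := abs_le.1 (hone hμ hPμ)
    rw [abs_le]
    constructor <;> linarith [h1.1, h1.2, h2.1, h2.2]
  rw [← sub_eq_zero, ← abs_eq_zero]
  refine le_antisymm (le_of_forall_pos_le_add fun ε hε => ?_) (abs_nonneg _)
  have hpos : 0 < ν.real Set.univ + μ.real Set.univ + 1 := by positivity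
  refine (hclose (ε / (ν.real Set.univ + μ.real Set.univ + 1)) (by positivity)).trans ?_
  rw [zero_add, div_mul_eq_mul_div, div_le_iff₀ hpos]
  nlinarith

/-! ### The Kesten law as the law of the moment sequence -/

theorem theorem2p1 (p q : ℝ) (hp : 0 ≤ p) (hq : 0 ≤ q) (hpq : 0 < p + q) :
    -- the Kesten law is a probability measure with the moments `kestenMoment p q`
    IsProbabilityMeasure (kestenLaw p q) ∧
    HasMoments (kestenLaw p q) (kestenMoment p q) ∧
    -- it is the only Borel measure with these moments
    (∀ ν : Measure ℝ, HasMoments ν (kestenMoment p q) → ν = kestenLaw p q) ∧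
    -- its Cauchy transform, off the segment and off the zeros of the denominator
    -- (in particular off the atoms, if there are any)
    (∀ z : ℂ, (∀ x ∈ Set.Icc (-Real.sqrt (2 * (p + q))) (Real.sqrt (2 * (p + q))), z ≠ (x : ℂ)) →
      2 - (2 - (p : ℂ) - (q : ℂ)) * z ^ 2 ≠ 0 →
      Integrable (fun x : ℝ => 1 / (z - (x : ℂ))) (kestenLaw p q) ∧
      ∫ x : ℝ, 1 / (z - (x : ℂ)) ∂(kestenLaw p q) =
        (((p : ℂ) + (q : ℂ) - 1) * z - sqrtBranch (Real.sqrt (2 * (p + q))) z) /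
          (2 - (2 - (p : ℂ) - (q : ℂ)) * z ^ 2)) := by
  refine ⟨isProbabilityMeasure_kestenLaw hpq, hasMoments_kestenLaw hpq, fun ν hν => ?_,
    fun z hz hd => integral_kestenLaw_cauchy hpq hz hd⟩
  obtain ⟨R, hR⟩ := exists_abs_le_ae_kestenLaw p q
  exact eq_of_hasMoments hR (hasMoments_kestenLaw hpq) hν
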